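/- **Setting.** Let $d\in\mathbb N$, let $\pi_u:\mathbb R^d\to(0,\infty)$ be a probability density with Gaussian tails, i.e. $\pi_u(x)\le A e^{-a\|x\|^2}$ for some $A$ and $a>0$ (for instance a nondegenerate Gaussian density, or one proportional to a Gaussian density times $e^{-\Psi}$ with $\Psi\ge 0$), and let $\nu_u(\mathrm dx)=\pi_u(x)\,\mathrm dx$. Let $\varepsilon_0>0$. For potentials $\Phi_\varepsilon:\mathbb R^d\to\mathbb R$, $0<\varepsilon\le\varepsilon_0$, put $$\nu_\varepsilon(\mathrm du)=\frac1{Z_\varepsilon}e^{-\Phi_\varepsilon(u)/\varepsilon}\,\nu_u(\mathrm du),\qquad Z_\varepsilon=\int e^{-\Phi_\varepsilon/\varepsilon}\,\mathrm d\nu_u,\qquad I_\varepsilon=\Phi_\varepsilon-\varepsilon\log\pi_u .$$ **Assumption (A)** on $(\Phi_\varepsilon)_\varepsilon$ and points $u_\varepsilon\in\mathbb R^d$: 1. $\Phi_\varepsilon\ge -c$ on $\mathbb R^d$ for all $0<\varepsilon\le\varepsilon_0$, with a constant $c$ independent of $\varepsilon$; 2. $\pi_u$ and all $\Phi_\varepsilon$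 are $C^3$; $u_\varepsilon$ is the unique minimizer of $I_\varepsilon$, with $I_\varepsilon(u_\varepsilon)=0$, $\nabla I_\varepsilon(u_\varepsilon)=0$ and $\nabla^2I_\varepsilon(u_\varepsilon)$ positive definite, for all $0<\varepsilon\le\varepsilon_0$; 3. as $\varepsilon\downarrow0$, $u_\varepsilon$ converges in $\mathbb R^d$ and $\nabla^2\Phi_\varepsilon(u_\varepsilon)$ converges to a positive definite matrix; 4. for each $r>0$ there are $\varepsilon_r>0$, $\delta_r>0$, $K_r<\infty$ such that for all $0<\varepsilon\le\varepsilon_r$: $I_\varepsilon(x)\ge\delta_r$ for every $x\notin B_r(u_\varepsilon)$, and $\|\nabla^3\log\pi_u(x)\|\le K_r$, $\|\nabla^3\Phi_\varepsilon(x)\|\le K_r$ for every $\|x\|\le r$. The Laplace approximation of $\nu_\varepsilon$ is $\mathcal L_\varepsilon=\mathcal N(u_\varepsilon,\varepsilon C_\varepsilon)$, $C_\varepsilon^{-1}=\nabla^2I_\varepsilon(u_\varepsilon)$; let $\ell_\varepsilon$ be its Lebesgue density. **Theorem.** (a) Under (A), $D_{\mathrm{KL}}(\nu_\varepsilon\,\|\,\mathcal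 L_\varepsilon)$ is finite for all small $\varepsilon>0$ and $$D_{\mathrm{KL}}(\nu_\varepsilon\,\|\,\mathcal L_\varepsilon)=O(\varepsilon^{1/2})\qquad(\varepsilon\downarrow0).$$ (b) Let the observations $y^{(\varepsilon)}$ be random, on a common probability space, and let $\Phi_\varepsilon=\Phi_\varepsilon(\cdot\,;y^{(\varepsilon)})$, $u_\varepsilon=u_\varepsilon(y^{(\varepsilon)})$, $\nu_\varepsilon$, $\mathcal L_\varepsilon$, $\ell_\varepsilon$ be the corresponding random objects. Suppose that (A) holds almost surely (with constants and limits that may depend on the realization, but with $\varepsilon_0$ fixed), and that for all $0<\varepsilon\le\varepsilon_0$ the variable $D_{\mathrm{KL}}(\nu_\varepsilon\|\nu_u)$ is integrable, and $D_{\mathrm{KL}}(\nu_\varepsilon\|\mathcal L_\varepsilon)$ is measurable and almost surely at most $\kappa$, where $\kappa$ is an integrable random variable that does not depend on $\varepsilon$. Put $$\mathrm{EIG}_\varepsilon=\mathbb E\big[D_{\mathrm{KL}}(\nu_\varepsilon\|\nu_u)\big],\qquad \mathrm{LB}_\varepsilon=\mathbb E\Big[\int\log\frac{\ell_\varepsilon(x)}{\pi_u(x)}\,\nu_\varepsilon(\mathrm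 dx)\Big].$$ Then for all $0<\varepsilon\le\varepsilon_0$ the outer expectation in $\mathrm{LB}_\varepsilon$ is that of an integrable variable and $\mathrm{LB}_\varepsilon\le\mathrm{EIG}_\varepsilon$, and the bound becomes tight: $\mathrm{EIG}_\varepsilon-\mathrm{LB}_\varepsilon\to0$ as $\varepsilon\downarrow0$. -/

import Mathlib

open MeasureTheory ProbabilityTheory Filter Topology Asymptotics InformationTheory

noncomputable section

namespace LaplaceKL

/-- The Hessian matrix `∇² f (x)` of a function on `ℝ^d`. -/
def hessian {d : ℕ} (f : EuclideanSpace ℝ (Fin d) → ℝ) (x : EuclideanSpace ℝ (Fin d)) :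
    Matrix (Fin d) (Fin d) ℝ :=
  Matrix.of fun i j =>
    iteratedFDeriv ℝ 2 f x ![EuclideanSpace.single i (1 : ℝ), EuclideanSpace.single j (1 : ℝ)]

/-- `prior` is a positive probability density with Gaussian tails. This is the case for a
nondegenerate Gaussian density, and for every density proportional to `exp (-Ψ)` times a Gaussian
density with `Ψ ≥ 0`, i.e. for a prior that is the posterior of earlier steps started from a
Gaussian prior. -/
structure IsPriorDensity {d : ℕ} (prior : EuclideanSpace ℝ (Fin d) → ℝ) : Prop where
  pos : ∀ x, 0 < prior x
  integral_eq_one : ∫ x, prior x = 1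
  gaussian_tail : ∃ A a : ℝ, 0 < a ∧ ∀ x, prior x ≤ A * Real.exp (-a * ‖x‖ ^ 2)

/-- The prior measure with Lebesgue density `prior`. -/
def priorMeasure {d : ℕ} (prior : EuclideanSpace ℝ (Fin d) → ℝ) :
    Measure (EuclideanSpace ℝ (Fin d)) :=
  volume.withDensity fun x => ENNReal.ofReal (prior x)

/-- The posterior `Z⁻¹ exp (-φ / ε) · prior`, with `Z` the normalizing constant. -/
def posterior {d : ℕ} (prior φ : EuclideanSpace ℝ (Fin d) → ℝ) (ε : ℝ) :
    Measure (EuclideanSpace ℝ (Fin d)) :=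
  (priorMeasure prior).tilted fun x => -(1 / ε) * φ x

/-- `I_ε = φ - ε log prior`. -/
def regPotential {d : ℕ} (prior φ : EuclideanSpace ℝ (Fin d) → ℝ) (ε : ℝ)
    (x : EuclideanSpace ℝ (Fin d)) : ℝ :=
  φ x - ε * Real.log (prior x)

/-- `C_ε`, the inverse of the Hessian of `I_ε` at `m`. -/
def laplaceCov {d : ℕ} (prior φ : EuclideanSpace ℝ (Fin d) → ℝ) (ε : ℝ)
    (m : EuclideanSpace ℝ (Fin d)) : Matrix (Fin d) (Fin d) ℝ :=
  (hessian (regPotential prior φ ε) m)⁻¹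

/-- The Laplace approximation `N(m, ε C_ε)`. -/
def laplaceApprox {d : ℕ} (prior φ : EuclideanSpace ℝ (Fin d) → ℝ) (ε : ℝ)
    (m : EuclideanSpace ℝ (Fin d)) : Measure (EuclideanSpace ℝ (Fin d)) :=
  multivariateGaussian m (ε • laplaceCov prior φ ε m)

/-- The Lebesgue density of the Laplace approximation: the exponential
`exp (-(x - m)ᵀ C_ε⁻¹ (x - m) / (2 ε))` divided by `ε^{d/2} √(det (2 π C_ε))`. -/
def laplaceDensity {d : ℕ} (prior φ : EuclideanSpace ℝ (Fin d) → ℝ) (ε : ℝ)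
    (m x : EuclideanSpace ℝ (Fin d)) : ℝ :=
  (ε ^ ((d : ℝ) / 2) * √(((2 * Real.pi) • laplaceCov prior φ ε m).det))⁻¹ *
    Real.exp (-(1 / (2 * ε)) *
      ((fun i => (x - m) i) ⬝ᵥ
        (hessian (regPotential prior φ ε) m).mulVec (fun i => (x - m) i)))

/-- The assumptions on the potentials `Φ ε` and the minimizers `u ε` of `I_ε`, for `0 < ε ≤ ε₀`. -/
structure LaplaceAssumption {d : ℕ} (ε₀ : ℝ) (prior : EuclideanSpace ℝ (Fin d) → ℝ)
    (Φ : ℝ → EuclideanSpace ℝ (Fin d) → ℝ) (u : ℝ → EuclideanSpace ℝ (Fin d)) : Prop where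
  contDiff_prior : ContDiff ℝ 3 prior
  contDiff_potential : ∀ ε, 0 < ε → ε ≤ ε₀ → ContDiff ℝ 3 (Φ ε)
  /-- `u ε` is the unique minimizer of `I_ε`. -/
  unique_min : ∀ ε, 0 < ε → ε ≤ ε₀ → ∀ x, x ≠ u ε →
    regPotential prior (Φ ε) ε (u ε) < regPotential prior (Φ ε) ε x
  min_eq_zero : ∀ ε, 0 < ε → ε ≤ ε₀ → regPotential prior (Φ ε) ε (u ε) = 0
  gradient_eq_zero : ∀ ε, 0 < ε → ε ≤ ε₀ → gradient (regPotential prior (Φ ε) ε) (u ε) = 0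
  hessian_posDef : ∀ ε, 0 < ε → ε ≤ ε₀ → (hessian (regPotential prior (Φ ε) ε) (u ε)).PosDef
  tendsto_min : ∃ uStar, Tendsto u (𝓝[>] 0) (𝓝 uStar)
  tendsto_hessian : ∃ HStar : Matrix (Fin d) (Fin d) ℝ, HStar.PosDef ∧
    Tendsto (fun ε => hessian (Φ ε) (u ε)) (𝓝[>] 0) (𝓝 HStar)
  separation_and_bounds : ∀ r : ℝ, 0 < r → ∃ εr δ K : ℝ, 0 < εr ∧ 0 < δ ∧
    ∀ ε, 0 < ε → ε ≤ εr →
      (∀ x, x ∉ Metric.ball (u ε) r → δ ≤ regPotential prior (Φ ε) ε x) ∧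
      (∀ x ∈ Metric.closedBall (0 : EuclideanSpace ℝ (Fin d)) r,
        ‖iteratedFDeriv ℝ 3 (fun z => Real.log (prior z)) x‖ ≤ K ∧
        ‖iteratedFDeriv ℝ 3 (Φ ε) x‖ ≤ K)

/-- The potentials are bounded below, uniformly in `ε`. Least-squares potentials, which are
nonnegative before a constant `c_ε` is subtracted in order to normalize `min I_ε` to zero, satisfy
this when the constants `c_ε` are bounded. -/
def UniformlyBoundedBelow {d : ℕ} (ε₀ : ℝ) (Φ : ℝ → EuclideanSpace ℝ (Fin d) → ℝ) : Prop :=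
  ∃ c : ℝ, ∀ ε, 0 < ε → ε ≤ ε₀ → ∀ x, -c ≤ Φ ε x

/-- The expected information gain: the mean over the observation `y` of the divergence
of the posterior given `y` from the prior. The potential for the observation `y` is `φ y`. -/
def EIG {d : ℕ} {Y Ω : Type*} [MeasurableSpace Ω] (P : Measure Ω)
    (prior : EuclideanSpace ℝ (Fin d) → ℝ) (φ : Y → EuclideanSpace ℝ (Fin d) → ℝ)
    (y : Ω → Y) (ε : ℝ) : ℝ :=
  ∫ ω, (klDiv (posterior prior (φ (y ω)) ε) (priorMeasure prior)).toReal ∂P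

/-- The inner (posterior) expectation of the log-ratio of the Laplace density and the prior. -/
def laplaceGain {d : ℕ} (prior φ : EuclideanSpace ℝ (Fin d) → ℝ) (ε : ℝ)
    (m : EuclideanSpace ℝ (Fin d)) : ℝ :=
  ∫ x, Real.log (laplaceDensity prior φ ε m x / prior x) ∂(posterior prior φ ε)

/-- The lower bound on the expected information gain based on the Laplace approximation: the
expectation of `log (laplaceDensity / prior)` over the joint law of observation and parameter. -/
def EIGLaplaceLowerBound {d : ℕ} {Y Ω : Type*} [MeasurableSpace Ω] (P : Measure Ω)
    (prior : EuclideanSpace ℝ (Fin d) → ℝ) (φ : Y → EuclideanSpace ℝ (Fin d) → ℝ)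
    (m : Y → EuclideanSpace ℝ (Fin d)) (y : Ω → Y) (ε : ℝ) : ℝ :=
  ∫ ω, laplaceGain prior (φ (y ω)) ε (m (y ω)) ∂P

end LaplaceKL

end

/-! Write `I` for `I_ε`, `q` for half its Hessian form centered at `m = u_ε`, and `Z`, `W` for the
integrals of `exp (-I/ε)`, `exp (-q/ε)`. The posterior and the Laplace approximation have densities
`exp (-I/ε)/Z` and `exp (-q/ε)/W`, so the divergence is the posterior mean of `(q - I)/ε` plus `log
(W/Z)` (`toReal_klDiv_laplaceApprox_eq`). Since the divergence is nonnegative, only upper bounds on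
these two terms are needed.

Put `ε = s²`. Near `m`, Taylor's formula gives `|I - q| ≤ K‖x - m‖³`; the mass lives at distance of
order `s`, so the cubic error divided by `ε` has size `s³/s² = s`. Away from `m`, `I ≥ δ` makes the
weight exponentially small, and the Gaussian tail of the prior makes it integrable. A convex
combination of these two lower bounds on `I` gives both effects at once
(`potential_ge_interpolated`). Hence `Z ≥ W(1 - O(s))` and the remainder integral is `O(s^(d+1))`,
while `Z` is at least of order `s^d`; `exists_laplace_bound` combines these uniformly in the
potential.

For (b), splitting the logarithm of the density ratio gives, for almost every realization,
divergence from the prior = divergence from the Laplace approximation + gain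
(`toReal_klDiv_priorMeasure`). Thus `EIG - LB` is the mean of a nonnegative quantity tending to zero
by (a), and dominated convergence concludes. -/

namespace LaplaceKL

/-! ### Divergences between measures given by positive densities -/

section Densities

open scoped ENNReal

variable {α β : Type*} {mα : MeasurableSpace α} {mβ : MeasurableSpace β}

lemma map_withDensity_comp {μ : Measure α} {f : α → β} (hf : Measurable f) {g : β → ℝ≥0∞}
    (hg : Measurable g) : (μ.withDensity (g ∘ f)).map f = (μ.map f).withDensity g := by
  ext s hs
  rw [Measure.map_apply hf hs, withDensity_apply _ (hf hs), withDensity_apply _ hs,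
    setLIntegral_map hs hg hf]
  rfl

lemma withDensity_ofReal_eq_withDensity_div {μ : Measure α} {p q : α → ℝ} (hp : Measurable p)
    (hq : Measurable q) (hq0 : ∀ x, 0 < q x) :
    μ.withDensity (fun x => ENNReal.ofReal (p x)) =
      (μ.withDensity fun x => ENNReal.ofReal (q x)).withDensity
        fun x => ENNReal.ofReal (p x / q x) := by
  rw [← withDensity_mul _ (by fun_prop) (by fun_prop)]
  congr 1
  ext x
  rw [Pi.mul_apply, ← ENNReal.ofReal_mul (hq0 x).le, mul_div_cancel₀ _ (hq0 x).ne']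

lemma withDensity_ofReal_absolutelyContinuous {μ : Measure α} {p q : α → ℝ} (hp : Measurable p)
    (hq : Measurable q) (hq0 : ∀ x, 0 < q x) :
    μ.withDensity (fun x => ENNReal.ofReal (p x)) ≪
      μ.withDensity fun x => ENNReal.ofReal (q x) := by
  rw [withDensity_ofReal_eq_withDensity_div hp hq hq0]
  exact withDensity_absolutelyContinuous _ _

lemma llr_withDensity_ofReal {μ : Measure α} {p q : α → ℝ} (hp : Measurable p) (hq : Measurable q)
    (hp0 : ∀ x, 0 < p x) (hq0 : ∀ x, 0 < q x)
    [SigmaFinite (μ.withDensity fun x => ENNReal.ofReal (q x))] :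
    llr (μ.withDensity fun x => ENNReal.ofReal (p x))
        (μ.withDensity fun x => ENNReal.ofReal (q x))
      =ᵐ[μ.withDensity fun x => ENNReal.ofReal (p x)] fun x => Real.log (p x / q x) := by
  have h := Measure.rnDeriv_withDensity (μ.withDensity fun x => ENNReal.ofReal (q x))
    (f := fun x => ENNReal.ofReal (p x / q x)) (by fun_prop)
  rw [← withDensity_ofReal_eq_withDensity_div hp hq hq0] at h
  filter_upwards [(withDensity_ofReal_absolutelyContinuous hp hq hq0).ae_le h] with x hx
  rw [llr_def]
  simp only [hx]
  rw [ENNReal.toReal_ofReal (div_pos (hp0 x) (hq0 x)).le]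

lemma klDiv_withDensity_ofReal_ne_top {μ : Measure α} {p q : α → ℝ} (hp : Measurable p)
    (hq : Measurable q) (hp0 : ∀ x, 0 < p x) (hq0 : ∀ x, 0 < q x)
    [SigmaFinite (μ.withDensity fun x => ENNReal.ofReal (q x))]
    (hint : Integrable (fun x => Real.log (p x / q x))
      (μ.withDensity fun x => ENNReal.ofReal (p x))) :
    klDiv (μ.withDensity fun x => ENNReal.ofReal (p x))
      (μ.withDensity fun x => ENNReal.ofReal (q x)) ≠ ⊤ :=
  klDiv_ne_top (withDensity_ofReal_absolutelyContinuous hp hq hq0)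
    (hint.congr (llr_withDensity_ofReal hp hq hp0 hq0).symm)

lemma toReal_klDiv_withDensity_ofReal {μ : Measure α} {p q : α → ℝ} (hp : Measurable p)
    (hq : Measurable q) (hp0 : ∀ x, 0 < p x) (hq0 : ∀ x, 0 < q x)
    [IsProbabilityMeasure (μ.withDensity fun x => ENNReal.ofReal (p x))]
    [IsProbabilityMeasure (μ.withDensity fun x => ENNReal.ofReal (q x))] :
    (klDiv (μ.withDensity fun x => ENNReal.ofReal (p x))
      (μ.withDensity fun x => ENNReal.ofReal (q x))).toReal =
      ∫ x, Real.log (p x / q x) ∂(μ.withDensity fun x => ENNReal.ofReal (p x)) := by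
  rw [toReal_klDiv_of_measure_eq (withDensity_ofReal_absolutelyContinuous hp hq hq0) (by simp)]
  exact integral_congr_ae (llr_withDensity_ofReal hp hq hp0 hq0)

end Densities

/-! ### Lebesgue densities of Gaussian measures -/

section Gaussian

open scoped MatrixOrder RealInnerProductSpace Matrix

variable {d : ℕ}

/-- Both sides are finite measures with the same characteristic function; that of the right side is
the Fourier transform of a Gaussian. -/
lemma stdGaussian_eq_withDensity :
    stdGaussian (EuclideanSpace ℝ (Fin d)) = volume.withDensity fun x =>
      ENNReal.ofReal (((2 * Real.pi) ^ ((d : ℝ) / 2))⁻¹ * Real.exp (-(1 / 2) * ‖x‖ ^ 2)) := by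
  set c : ℝ := ((2 * Real.pi) ^ ((d : ℝ) / 2))⁻¹ with hc
  have hc0 : 0 < c := by positivity
  have hI := GaussianFourier.integral_rexp_neg_mul_sq_norm (V := EuclideanSpace ℝ (Fin d))
    (b := 1 / 2) (by norm_num)
  have hint : Integrable (fun x : EuclideanSpace ℝ (Fin d) => Real.exp (-(1 / 2) * ‖x‖ ^ 2)) := by
    refine Integrable.of_integral_ne_zero ?_
    rw [hI]; positivity
  have : IsFiniteMeasure ((volume : Measure (EuclideanSpace ℝ (Fin d))).withDensity fun x =>
      ENNReal.ofReal (c * Real.exp (-(1 / 2) * ‖x‖ ^ 2))) :=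
    isFiniteMeasure_withDensity_ofReal (hint.const_mul c).2
  apply Measure.ext_of_charFun
  ext t
  rw [charFun_stdGaussian, charFun_apply, integral_withDensity_eq_integral_toReal_smul
    (by fun_prop) (by simp)]
  have h := GaussianFourier.integral_cexp_neg_mul_sq_norm_add (V := EuclideanSpace ℝ (Fin d))
    (b := 1 / 2) (by norm_num) Complex.I t
  have hfun : ∀ x : EuclideanSpace ℝ (Fin d),
      (ENNReal.ofReal (c * Real.exp (-(1 / 2) * ‖x‖ ^ 2))).toReal •
        Complex.exp (⟪x, t⟫ * Complex.I) =
      (c : ℂ) * Complex.exp (-(1 / 2) * ‖x‖ ^ 2 + Complex.I * ⟪t, x⟫) := by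
    intro x
    rw [ENNReal.toReal_ofReal (by positivity), Complex.exp_add, Complex.real_smul,
      real_inner_comm, mul_comm Complex.I]
    push_cast
    ring
  simp_rw [hfun]
  rw [integral_const_mul, h]
  have h2 : ((Real.pi : ℂ) / (1 / 2)) ^ ((Module.finrank ℝ (EuclideanSpace ℝ (Fin d)) : ℂ) / 2) =
      (c : ℂ)⁻¹ := by
    rw [hc, ← Complex.ofReal_inv, inv_inv, Complex.ofReal_cpow (by positivity),
      finrank_euclideanSpace, Fintype.card_fin]
    push_cast
    congr 1
    ring
  rw [h2, ← mul_assoc, mul_inv_cancel₀ (by exact_mod_cast hc0.ne'), one_mul]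
  congr 1
  rw [Complex.I_sq]
  ring

lemma sqrt_pow_eq_rpow_div_two {x : ℝ} (hx : 0 ≤ x) (n : ℕ) : √(x ^ n) = x ^ ((n : ℝ) / 2) := by
  rw [Real.sqrt_eq_rpow, ← Real.rpow_natCast_mul hx, mul_one_div]

/-- Change of variables along `x ↦ m + √S x`, which pushes the standard Gaussian to this measure;
the Jacobian is `|det √S|`. -/
lemma multivariateGaussian_eq_withDensity (m : EuclideanSpace ℝ (Fin d))
    {S : Matrix (Fin d) (Fin d) ℝ} (hS : S.PosDef) :
    multivariateGaussian m S = volume.withDensity fun x => ENNReal.ofReal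
      ((√((2 * Real.pi) • S).det)⁻¹ *
        Real.exp (-(1 / 2) * ((fun i => (x - m) i) ⬝ᵥ S⁻¹ *ᵥ (fun i => (x - m) i)))) := by
  set Q := CFC.sqrt S with hQ
  have hQQ : Q * Q = S := CFC.sqrt_mul_sqrt_self S hS.posSemidef.nonneg
  have hQT : Qᵀ = Q := by
    have := (CFC.sqrt_nonneg S).isSelfAdjoint
    rw [IsSelfAdjoint, Matrix.star_eq_conjTranspose, Matrix.conjTranspose_eq_transpose_of_trivial]
      at this
    exact this
  have hdet : Q.det * Q.det = S.det := by rw [← Matrix.det_mul, hQQ]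
  have hSdet : 0 < S.det := hS.det_pos
  have hQdet : Q.det ≠ 0 := by
    intro h; rw [h] at hdet; simp at hdet; exact hSdet.ne hdet
  set T := Matrix.toEuclideanCLM (𝕜 := ℝ) Q with hT
  have hTdet : LinearMap.det (T : EuclideanSpace ℝ (Fin d) →ₗ[ℝ] EuclideanSpace ℝ (Fin d)) =
      Q.det := by
    have : (T : EuclideanSpace ℝ (Fin d) →ₗ[ℝ] EuclideanSpace ℝ (Fin d)) =
        Matrix.toLin (EuclideanSpace.basisFun (Fin d) ℝ).toBasis
          (EuclideanSpace.basisFun (Fin d) ℝ).toBasis Q := rfl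
    rw [this, LinearMap.det_toLin]
  set c : ℝ := (√((2 * Real.pi) • S).det)⁻¹ with hc
  -- The target density times `|det Q|`: its pullback is exactly the standard density, and the
  -- factor cancels against the image of Lebesgue measure.
  set ρ : EuclideanSpace ℝ (Fin d) → ℝ := fun x => 
    |Q.det| * c * Real.exp (-(1 / 2) * ((fun i => (x - m) i) ⬝ᵥ S⁻¹ *ᵥ (fun i => (x - m) i)))
    with hρ
  have hρm : Measurable ρ := by
    apply Continuous.measurable
    simp only [hρ, dotProduct, Matrix.mulVec]
    fun_prop
  have hcomp : (fun x : EuclideanSpace ℝ (Fin d) => ENNReal.ofReal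
      (((2 * Real.pi) ^ ((d : ℝ) / 2))⁻¹ * Real.exp (-(1 / 2) * ‖x‖ ^ 2))) =
      (fun x => ENNReal.ofReal (ρ x)) ∘ fun x => m + T x := by
    ext x
    simp only [Function.comp_apply, hρ]
    congr 2
    · rw [hc, Matrix.det_smul, Fintype.card_fin, ← hdet, Real.sqrt_mul (by positivity),
        Real.sqrt_mul_self_eq_abs, sqrt_pow_eq_rpow_div_two (by positivity)]
      have := abs_pos.mpr hQdet
      field_simp
    · congr 2
      have hv : (fun i => (m + T x - m) i) = Q *ᵥ x.ofLp := by
        ext i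
        rw [add_sub_cancel_left, hT, Matrix.ofLp_toEuclideanCLM]
      have hQu : IsUnit Q.det := hQdet.isUnit
      have hQS : Q * (S⁻¹ * Q) = 1 := by
        rw [← hQQ, Matrix.mul_inv_rev, Matrix.mul_assoc, Matrix.nonsing_inv_mul _ hQu,
          Matrix.mul_one, Matrix.mul_nonsing_inv _ hQu]
      rw [hv, Matrix.mulVec_mulVec, Matrix.dotProduct_mulVec, ← Matrix.dotProduct_mulVec,
        ← Matrix.vecMul_transpose, ← Matrix.dotProduct_mulVec, hQT, Matrix.mulVec_mulVec, hQS,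
        Matrix.one_mulVec, EuclideanSpace.real_norm_sq_eq]
      simp [dotProduct, sq]
  rw [multivariateGaussian, stdGaussian_eq_withDensity, hcomp,
    map_withDensity_comp (by fun_prop) (by fun_prop)]
  have hmap : (volume : Measure (EuclideanSpace ℝ (Fin d))).map (fun x => m + T x) =
      ENNReal.ofReal |Q.det|⁻¹ • volume := by
    have : (fun x => m + T x) = (fun x => m + x) ∘ T := rfl
    rw [this, ← Measure.map_map (by fun_prop) (by fun_prop)]
    have h := Measure.map_linearMap_addHaar_eq_smul_addHaar
      (volume : Measure (EuclideanSpace ℝ (Fin d))) (f := (T : _ →ₗ[ℝ] _)) (by rwa [hTdet])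
    rw [hTdet, abs_inv] at h
    have h' : Measure.map T (volume : Measure (EuclideanSpace ℝ (Fin d))) =
        ENNReal.ofReal |Q.det|⁻¹ • volume := h
    rw [h', Measure.map_smul, Measure.IsAddLeftInvariant.map_add_left_eq_self]
  rw [hmap, withDensity_smul_measure, ← withDensity_smul _ (by fun_prop)]
  congr 1
  ext x
  simp only [Pi.smul_apply, smul_eq_mul, hρ]
  rw [← ENNReal.ofReal_mul (by positivity)]
  congr 1
  field_simp

lemma laplaceDensity_pos {prior φ : EuclideanSpace ℝ (Fin d) → ℝ} {ε : ℝ} (hε : 0 < ε)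
    {m : EuclideanSpace ℝ (Fin d)} (hH : (hessian (regPotential prior φ ε) m).PosDef)
    (x : EuclideanSpace ℝ (Fin d)) : 0 < laplaceDensity prior φ ε m x := by
  have h1 : 0 < ((2 * Real.pi) • laplaceCov prior φ ε m).det := by
    rw [Matrix.det_smul]
    have := hH.inv.det_pos
    unfold laplaceCov
    positivity
  unfold laplaceDensity
  positivity

lemma laplaceApprox_eq_withDensity {prior φ : EuclideanSpace ℝ (Fin d) → ℝ} {ε : ℝ} (hε : 0 < ε)
    {m : EuclideanSpace ℝ (Fin d)} (hH : (hessian (regPotential prior φ ε) m).PosDef) :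
    laplaceApprox prior φ ε m =
      volume.withDensity fun x => ENNReal.ofReal (laplaceDensity prior φ ε m x) := by
  have hC : (laplaceCov prior φ ε m).PosDef := hH.inv
  rw [laplaceApprox, multivariateGaussian_eq_withDensity m (hC.smul hε)]
  congr 1
  ext x
  rw [laplaceDensity]
  congr 2
  · congr 1
    rw [smul_comm, Matrix.det_smul, Fintype.card_fin, Real.sqrt_mul (by positivity),
      sqrt_pow_eq_rpow_div_two hε.le]
  · have : (ε • laplaceCov prior φ ε m)⁻¹ = ε⁻¹ • hessian (regPotential prior φ ε) m := by
      have hdet := hH.det_pos.ne'.isUnit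
      apply Matrix.inv_eq_right_inv
      rw [laplaceCov, Matrix.smul_mul, Matrix.mul_smul, Matrix.nonsing_inv_mul _ hdet, smul_smul,
        mul_inv_cancel₀ hε.ne', one_smul]
    rw [this, Matrix.smul_mulVec, dotProduct_smul, smul_eq_mul]
    congr 1
    ring

end Gaussian

/-! ### Gaussian moments and their scaling -/

lemma norm_pow_mul_exp_rescaled_eq {V : Type*} [SeminormedAddCommGroup V]
    [NormedSpace ℝ V] (k : ℕ) (b : ℝ) {s : ℝ} (hs : 0 < s) (y : V) :
    ‖y‖ ^ k * Real.exp (-(b * ‖y‖ ^ 2 / s ^ 2)) =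
      s ^ k * (‖s⁻¹ • y‖ ^ k * Real.exp (-b * ‖s⁻¹ • y‖ ^ 2)) := by
  rw [norm_smul, norm_inv, Real.norm_of_nonneg hs.le, mul_pow, inv_pow]
  field_simp

lemma exp_neg_div_le_of_growth {V : Type*} [SeminormedAddCommGroup V] {I : V → ℝ}
    {ε a α c : ℝ} (hε : 0 < ε)
    (hI : ∀ x, ε * (a * ‖x‖ ^ 2 - α) - c ≤ I x) (x : V) :
    Real.exp (-(I x / ε)) ≤ Real.exp (α + c / ε) * Real.exp (-a * ‖x‖ ^ 2) := by
  rw [← Real.exp_add, Real.exp_le_exp]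
  have : (ε * (a * ‖x‖ ^ 2 - α) - c) / ε ≤ I x / ε := by gcongr; exact hI x
  rw [sub_div, mul_div_cancel_left₀ _ hε.ne'] at this
  linarith

section GaussianMoments

variable {V : Type*} [NormedAddCommGroup V] [InnerProductSpace ℝ V] [FiniteDimensional ℝ V]
  [MeasurableSpace V] [BorelSpace V]

variable (V) in
/-- The Gaussian moment `∫ ‖x‖ ^ k * exp (-b * ‖x‖ ^ 2)`. -/
noncomputable def gaussMoment (k : ℕ) (b : ℝ) : ℝ := ∫ x : V, ‖x‖ ^ k * Real.exp (-b * ‖x‖ ^ 2)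

lemma integrable_exp_neg_mul_sq_norm {b : ℝ} (hb : 0 < b) :
    Integrable fun x : V => Real.exp (-b * ‖x‖ ^ 2) := by
  refine Integrable.of_integral_ne_zero ?_
  rw [GaussianFourier.integral_rexp_neg_mul_sq_norm hb]
  positivity

/-- The power is at most `k! exp ‖x‖`, and completing the square bounds `‖x‖` by a constant plus
`b/2 * ‖x‖²`, which leaves half of the decay. -/
lemma integrable_norm_pow_mul_exp (k : ℕ) {b : ℝ} (hb : 0 < b) :
    Integrable fun x : V => ‖x‖ ^ k * Real.exp (-b * ‖x‖ ^ 2) := by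
  refine ((integrable_exp_neg_mul_sq_norm (V := V) (half_pos hb)).const_mul
    (k.factorial * Real.exp (1 / (2 * b)))).mono' (by fun_prop) (ae_of_all _ fun x => ?_)
  rw [Real.norm_of_nonneg (by positivity)]
  have h1 : ‖x‖ ^ k ≤ k.factorial * Real.exp ‖x‖ := by
    have := Real.pow_div_factorial_le_exp ‖x‖ (norm_nonneg _) k
    rwa [div_le_iff₀' (by positivity)] at this
  have h2 : ‖x‖ ≤ 1 / (2 * b) + b / 2 * ‖x‖ ^ 2 := by
    have : 1 / (2 * b) + b / 2 * ‖x‖ ^ 2 - ‖x‖ = (b * ‖x‖ - 1) ^ 2 / (2 * b) := by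
      field_simp; ring
    have : 0 ≤ (b * ‖x‖ - 1) ^ 2 / (2 * b) := by positivity
    linarith
  calc ‖x‖ ^ k * Real.exp (-b * ‖x‖ ^ 2)
      ≤ k.factorial * Real.exp (1 / (2 * b) + b / 2 * ‖x‖ ^ 2) * Real.exp (-b * ‖x‖ ^ 2) := by
        gcongr
        exact h1.trans (by gcongr)
    _ = _ := by
        rw [mul_assoc, mul_assoc, ← Real.exp_add, ← Real.exp_add]
        congr 2
        ring

lemma gaussMoment_nonneg (k : ℕ) (b : ℝ) : 0 ≤ gaussMoment V k b :=
  integral_nonneg fun x => by positivity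

lemma gaussMoment_zero_pos {b : ℝ} (hb : 0 < b) : 0 < gaussMoment V 0 b := by
  simp only [gaussMoment, pow_zero, one_mul]
  rw [GaussianFourier.integral_rexp_neg_mul_sq_norm hb]
  positivity

lemma integrable_norm_pow_mul_exp_rescaled (k : ℕ) {b s : ℝ} (hb : 0 < b) (hs : 0 < s) (m : V) :
    Integrable fun x : V => ‖x - m‖ ^ k * Real.exp (-(b * ‖x - m‖ ^ 2 / s ^ 2)) := by
  refine Integrable.comp_sub_right
    (f := fun y => ‖y‖ ^ k * Real.exp (-(b * ‖y‖ ^ 2 / s ^ 2))) ?_ m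
  simp_rw [norm_pow_mul_exp_rescaled_eq k b hs]
  exact ((integrable_norm_pow_mul_exp k hb).comp_smul (inv_ne_zero hs.ne')).const_mul _

/-- Source of all powers of `s`: a cubic error divided by `s²` costs `s^(n+1)`, one power better
than the normalizing constant. -/
lemma integral_norm_pow_mul_exp_rescaled (k : ℕ) (b : ℝ) {s : ℝ} (hs : 0 < s) (m : V) :
    ∫ x : V, ‖x - m‖ ^ k * Real.exp (-(b * ‖x - m‖ ^ 2 / s ^ 2)) =
      s ^ (Module.finrank ℝ V + k) * gaussMoment V k b := by
  rw [integral_sub_right_eq_self (fun y => ‖y‖ ^ k * Real.exp (-(b * ‖y‖ ^ 2 / s ^ 2))) m]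
  simp_rw [norm_pow_mul_exp_rescaled_eq k b hs]
  rw [integral_const_mul, Measure.integral_comp_inv_smul volume
    (fun y => ‖y‖ ^ k * Real.exp (-b * ‖y‖ ^ 2)), abs_of_pos (by positivity), gaussMoment,
    smul_eq_mul, ← mul_assoc, pow_add, mul_comm (s ^ k)]

end GaussianMoments

/-! ### Integrability against `exp (-I/ε)` under quadratic growth -/

section Integrability

variable {V : Type*} [NormedAddCommGroup V] [InnerProductSpace ℝ V] [FiniteDimensional ℝ V]
  [MeasurableSpace V] [BorelSpace V]

lemma integrable_norm_pow_mul_exp_neg_div (k : ℕ) {I : V → ℝ} (hIc : Continuous I)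
    {ε a α c : ℝ} (hε : 0 < ε) (ha : 0 < a) (hI : ∀ x, ε * (a * ‖x‖ ^ 2 - α) - c ≤ I x) :
    Integrable fun x => ‖x‖ ^ k * Real.exp (-(I x / ε)) := by
  refine ((integrable_norm_pow_mul_exp (V := V) k ha).const_mul (Real.exp (α + c / ε))).mono'
    (by fun_prop) (ae_of_all _ fun x => ?_)
  rw [Real.norm_of_nonneg (by positivity), mul_left_comm]
  gcongr
  exact exp_neg_div_le_of_growth hε hI x

lemma integrable_exp_neg_div {I : V → ℝ} (hIc : Continuous I)
    {ε a α c : ℝ} (hε : 0 < ε) (ha : 0 < a) (hI : ∀ x, ε * (a * ‖x‖ ^ 2 - α) - c ≤ I x) :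
    Integrable fun x => Real.exp (-(I x / ε)) := by
  simpa using integrable_norm_pow_mul_exp_neg_div 0 hIc hε ha hI

lemma integrable_mul_exp_neg_div_of_le_sq {I q : V → ℝ} (hIc : Continuous I) (hqc : Continuous q)
    {ε a α c M : ℝ} {m : V} (hε : 0 < ε) (ha : 0 < a)
    (hI : ∀ x, ε * (a * ‖x‖ ^ 2 - α) - c ≤ I x) (hq : ∀ x, |q x| ≤ M * ‖x - m‖ ^ 2) :
    Integrable fun x => q x * Real.exp (-(I x / ε)) := by
  have h2 := integrable_norm_pow_mul_exp_neg_div 2 hIc hε ha hI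
  have h0 := integrable_exp_neg_div hIc hε ha hI
  refine ((h2.const_mul (2 * |M|)).add (h0.const_mul (2 * |M| * ‖m‖ ^ 2))).mono' (by fun_prop)
    (ae_of_all _ fun x => ?_)
  simp only [Pi.add_apply]
  rw [norm_mul, Real.norm_eq_abs, Real.norm_of_nonneg (Real.exp_pos _).le]
  have h3 : ‖x - m‖ ^ 2 ≤ 2 * ‖x‖ ^ 2 + 2 * ‖m‖ ^ 2 := by
    have h4 : ‖x - m‖ ≤ ‖x‖ + ‖m‖ := norm_sub_le _ _
    nlinarith [norm_nonneg (x - m), sq_nonneg (‖x‖ - ‖m‖)]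
  have h5 : |q x| ≤ 2 * |M| * ‖x‖ ^ 2 + 2 * |M| * ‖m‖ ^ 2 := by
    calc |q x| ≤ M * ‖x - m‖ ^ 2 := hq x
      _ ≤ |M| * (2 * ‖x‖ ^ 2 + 2 * ‖m‖ ^ 2) := by gcongr; exact le_abs_self M
      _ = _ := by ring
  calc |q x| * Real.exp (-(I x / ε))
      ≤ (2 * |M| * ‖x‖ ^ 2 + 2 * |M| * ‖m‖ ^ 2) * Real.exp (-(I x / ε)) := by gcongr
    _ = _ := by ring

/-- Half of the exponent absorbs the factor: `I/(2ε) ≤ exp (I/(2ε))`. The other half satisfies the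
same growth bound with `ε` doubled and `a`, `α` halved. -/
lemma integrable_self_mul_exp_neg_div {I : V → ℝ} (hIc : Continuous I)
    {ε a α c : ℝ} (hε : 0 < ε) (ha : 0 < a) (hI : ∀ x, ε * (a * ‖x‖ ^ 2 - α) - c ≤ I x)
    (hI0 : ∀ x, 0 ≤ I x) : Integrable fun x => I x * Real.exp (-(I x / ε)) := by
  refine ((integrable_exp_neg_div hIc (ε := 2 * ε) (a := a / 2) (α := α / 2) (c := c) (by positivity)
    (by positivity) fun x => ?_).const_mul (2 * ε)).mono' (by fun_prop) (ae_of_all _ fun x => ?_)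
  · have := hI x
    linarith
  · rw [Real.norm_of_nonneg (mul_nonneg (hI0 x) (Real.exp_pos _).le)]
    have h1 : I x / (2 * ε) ≤ Real.exp (I x / (2 * ε)) := by
      linarith [Real.add_one_le_exp (I x / (2 * ε))]
    rw [div_le_iff₀' (by positivity)] at h1
    have h2 : -(I x / ε) = -(I x / (2 * ε)) + -(I x / (2 * ε)) := by field_simp; ring
    rw [h2, Real.exp_add, ← mul_assoc]
    refine mul_le_mul_of_nonneg_right ?_ (Real.exp_pos _).le
    rw [Real.exp_neg, ← div_eq_mul_inv, div_le_iff₀ (Real.exp_pos _)]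
    exact h1

end Integrability

/-! ### The quantitative Laplace estimate -/

lemma exp_neg_div_sq_le_pow (n : ℕ) {δ s : ℝ} (hδ : 0 < δ) (hs : 0 < s) (hs1 : s ≤ 1) :
    Real.exp (-(δ / (2 * s ^ 2))) / s ^ 2 ≤ (n + 3).factorial * (2 / δ) ^ (n + 3) * s ^ (n + 1) := by
  have h := Real.pow_div_factorial_le_exp (δ / (2 * s ^ 2)) (by positivity) (n + 3)
  have h1 : Real.exp (-(δ / (2 * s ^ 2))) ≤
      (n + 3).factorial * (2 / δ) ^ (n + 3) * (s ^ 2) ^ (n + 3) := by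
    rw [Real.exp_neg, inv_le_comm₀ (Real.exp_pos _) (by positivity)]
    refine le_trans (le_of_eq ?_) h
    rw [div_pow, div_pow, mul_pow]
    field_simp
  rw [div_le_iff₀ (by positivity)]
  refine h1.trans ?_
  rw [mul_assoc]
  have h2 : (s ^ 2) ^ (n + 3) ≤ s ^ (n + 1) * s ^ 2 := by
    rw [← pow_mul, ← pow_add]
    exact pow_le_pow_of_le_one hs.le hs1 (by omega)
  rw [mul_assoc, mul_assoc]
  gcongr

/-- The growth bound alone would cost a factor `exp (c/ε)`. Taking it with weight `θ = δ/(2(δ + c))`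
and the bound `δ` with weight `1 - θ` makes the constants combine to `(1 - θ)δ - θc = δ/2`. -/
lemma potential_ge_interpolated {I δ c ε a α t : ℝ} (hδ : 0 < δ) (hc : 0 ≤ c) (hε : 0 < ε)
    (h1 : δ ≤ I) (h2 : ε * (a * t - α) - c ≤ I) :
    -(I / ε) ≤ δ / (2 * (δ + c)) * α + -(δ / (2 * ε)) + -(a * (δ / (2 * (δ + c)))) * t := by
  set θ := δ / (2 * (δ + c)) with hθ
  have hθ0 : 0 < θ := by positivity
  have hθ1 : θ ≤ 1 := by
    rw [hθ, div_le_one (by positivity)]; linarith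
  have hθc : θ * (δ + c) = δ / 2 := by rw [hθ]; field_simp
  have h3 : (1 - θ) * δ + θ * (ε * (a * t - α) - c) ≤ I := by
    nlinarith [mul_le_mul_of_nonneg_left h1 (sub_nonneg.mpr hθ1),
      mul_le_mul_of_nonneg_left h2 hθ0.le]
  have h4 : δ / 2 + ε * (θ * (a * t - α)) ≤ I := by
    calc δ / 2 + ε * (θ * (a * t - α)) = (1 - θ) * δ + θ * (ε * (a * t - α) - c) := by
          linear_combination hθc
      _ ≤ I := h3
  have h5 : (δ / 2 + ε * (θ * (a * t - α))) / ε ≤ I / ε := by gcongr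
  rw [add_div, mul_div_cancel_left₀ _ hε.ne', div_div] at h5
  linarith

/-- Use `log y ≤ y - 1`, then `w - z ≤ wt` and `z ≥ w/2`. -/
lemma log_div_le_of_le {z w t : ℝ} (hw : 0 < w) (ht : t ≤ 1 / 2) (ht0 : 0 ≤ t)
    (h : w * (1 - t) ≤ z) : Real.log (w / z) ≤ 2 * t := by
  have hz : w / 2 ≤ z := by nlinarith
  have hz0 : 0 < z := by linarith
  have h1 := Real.log_le_sub_one_of_pos (div_pos hw hz0)
  refine h1.trans ?_
  rw [div_sub_one hz0.ne', div_le_iff₀ hz0]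
  nlinarith

section LaplaceEstimate

variable {V : Type*} [NormedAddCommGroup V] [InnerProductSpace ℝ V] [FiniteDimensional ℝ V]
  [MeasurableSpace V] [BorelSpace V]

/-- The normalizing constant of `exp (-I / ε)`, `ε = s ^ 2`, is at least `1 - O(s)` times that of
the Gaussian approximation. -/
lemma integral_gaussian_mul_le_integral {I q : V → ℝ} {m : V} {γ M K r s : ℝ} (hγ : 0 < γ)
    (hM : 0 < M) (hK : 0 < K) (hr : 0 < r) (hs : 0 < s) (hsr : s ^ 2 ≤ K * r ^ 3)
    (hqc : Continuous q)
    (hql : ∀ x, γ * ‖x - m‖ ^ 2 ≤ q x) (hqu : ∀ x, q x ≤ M * ‖x - m‖ ^ 2)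
    (hIq : ∀ x ∈ Metric.ball m r, |I x - q x| ≤ K * ‖x - m‖ ^ 3)
    (hint : Integrable fun x => Real.exp (-(I x / s ^ 2))) :
    s ^ Module.finrank ℝ V * gaussMoment V 0 M ≤ ∫ x, Real.exp (-(q x / s ^ 2)) ∧
    (∫ x, Real.exp (-(q x / s ^ 2))) *
      (1 - K * gaussMoment V 3 γ / gaussMoment V 0 M * s) ≤ ∫ x, Real.exp (-(I x / s ^ 2)) := by
  set n := Module.finrank ℝ V
  have hG0 := gaussMoment_zero_pos (V := V) hM
  have hg_le : ∀ x, Real.exp (-(q x / s ^ 2)) ≤ Real.exp (-(γ * ‖x - m‖ ^ 2 / s ^ 2)) := fun x => by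
    have := hql x; gcongr
  have hg_int : Integrable fun x => Real.exp (-(q x / s ^ 2)) := by
    refine (integrable_norm_pow_mul_exp_rescaled 0 hγ hs m).mono' (by fun_prop)
      (ae_of_all _ fun x => ?_)
    rw [Real.norm_of_nonneg (Real.exp_pos _).le, pow_zero, one_mul]
    exact hg_le x
  have hZ1 : s ^ n * gaussMoment V 0 M ≤ ∫ x, Real.exp (-(q x / s ^ 2)) := by
    have h := integral_norm_pow_mul_exp_rescaled (V := V) 0 M hs m
    rw [add_zero] at h
    rw [← h]
    refine integral_mono (integrable_norm_pow_mul_exp_rescaled 0 hM hs m) hg_int fun x => ?_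
    have := hqu x
    simp only [pow_zero, one_mul]
    gcongr
  refine ⟨hZ1, ?_⟩
  have h3_int := integrable_norm_pow_mul_exp_rescaled 3 hγ hs m
  have hpt : ∀ x, Real.exp (-(q x / s ^ 2)) -
      K / s ^ 2 * (‖x - m‖ ^ 3 * Real.exp (-(γ * ‖x - m‖ ^ 2 / s ^ 2))) ≤
        Real.exp (-(I x / s ^ 2)) := by
    intro x
    -- Inside the ball this is `1 - t ≤ exp (-t)`. Outside, `s² ≤ K r³` makes the left side
    -- nonpositive, so nothing about `I` is needed there.
    have h1 : Real.exp (-(q x / s ^ 2)) * (1 - K * ‖x - m‖ ^ 3 / s ^ 2) ≤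
        Real.exp (-(I x / s ^ 2)) := by
      by_cases hx : x ∈ Metric.ball m r
      · have h2 : I x ≤ q x + K * ‖x - m‖ ^ 3 := by linarith [le_abs_self (I x - q x), hIq x hx]
        have h3 : 1 - K * ‖x - m‖ ^ 3 / s ^ 2 ≤ Real.exp (-(K * ‖x - m‖ ^ 3 / s ^ 2)) := by
          linarith [Real.add_one_le_exp (-(K * ‖x - m‖ ^ 3 / s ^ 2))]
        calc _ ≤ Real.exp (-(q x / s ^ 2)) * Real.exp (-(K * ‖x - m‖ ^ 3 / s ^ 2)) := by gcongr
          _ = Real.exp (-((q x + K * ‖x - m‖ ^ 3) / s ^ 2)) := by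
            rw [← Real.exp_add]; congr 1; ring
          _ ≤ _ := by gcongr
      · have h2 : r ≤ ‖x - m‖ := by rwa [mem_ball_iff_norm, not_lt] at hx
        have h3 : 1 - K * ‖x - m‖ ^ 3 / s ^ 2 ≤ 0 := by
          rw [sub_nonpos, one_le_div (by positivity)]
          exact hsr.trans (by gcongr)
        exact (mul_nonpos_of_nonneg_of_nonpos (Real.exp_pos _).le h3).trans (Real.exp_pos _).le
    refine le_trans ?_ h1
    rw [mul_sub, mul_one]
    refine sub_le_sub_left ?_ _
    calc Real.exp (-(q x / s ^ 2)) * (K * ‖x - m‖ ^ 3 / s ^ 2)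
        ≤ Real.exp (-(γ * ‖x - m‖ ^ 2 / s ^ 2)) * (K * ‖x - m‖ ^ 3 / s ^ 2) := by
          exact mul_le_mul_of_nonneg_right (hg_le x) (by positivity)
      _ = _ := by ring
  have hmain := integral_mono (hg_int.sub (h3_int.const_mul (K / s ^ 2))) hint hpt
  simp only [Pi.sub_apply] at hmain
  rw [integral_sub hg_int (h3_int.const_mul _), integral_const_mul,
    integral_norm_pow_mul_exp_rescaled 3 γ hs m] at hmain
  refine le_trans ?_ hmain
  have e1 : K / s ^ 2 * (s ^ (n + 3) * gaussMoment V 3 γ) =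
      s ^ n * gaussMoment V 0 M * (K * gaussMoment V 3 γ / gaussMoment V 0 M * s) := by
    rw [pow_add]
    field_simp
  rw [mul_sub, mul_one]
  change _ ≤ _ - K / s ^ 2 * (s ^ (n + 3) * gaussMoment V 3 γ)
  rw [e1]
  have := gaussMoment_nonneg (V := V) 3 γ
  gcongr

/-- The posterior mean of the remainder of the quadratic expansion of the potential, before
normalization. -/
lemma integral_remainder_le {I q : V → ℝ} {m : V} {γ M K r δ c a α R s : ℝ} (hγ : 0 < γ)
    (hM : 0 < M) (hK : 0 < K) (hKr : K * r ≤ γ / 2) (hδ : 0 < δ) (hc : 0 ≤ c)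
    (ha : 0 < a) (hs : 0 < s) (hs1 : s ≤ 1) (hm : ‖m‖ ≤ R)
    (hql : ∀ x, γ * ‖x - m‖ ^ 2 ≤ q x) (hqu : ∀ x, q x ≤ M * ‖x - m‖ ^ 2)
    (hIq : ∀ x ∈ Metric.ball m r, |I x - q x| ≤ K * ‖x - m‖ ^ 3)
    (hIδ : ∀ x, x ∉ Metric.ball m r → δ ≤ I x)
    (hI : ∀ x, s ^ 2 * (a * ‖x‖ ^ 2 - α) - c ≤ I x)
    (hint : Integrable fun x => (q x - I x) / s ^ 2 * Real.exp (-(I x / s ^ 2))) :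
    ∫ x, (q x - I x) / s ^ 2 * Real.exp (-(I x / s ^ 2)) ≤
      (K * gaussMoment V 3 (γ / 2) +
        2 * M * Real.exp (δ / (2 * (δ + c)) * α) *
          ((Module.finrank ℝ V + 3).factorial * (2 / δ) ^ (Module.finrank ℝ V + 3)) *
          (gaussMoment V 2 (a * (δ / (2 * (δ + c)))) +
            R ^ 2 * gaussMoment V 0 (a * (δ / (2 * (δ + c)))))) *
        s ^ (Module.finrank ℝ V + 1) := by
  set n := Module.finrank ℝ V
  set θ := δ / (2 * (δ + c)) with hθ
  have hθ0 : 0 < θ := by positivity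
  have hb : 0 < a * θ := by positivity
  set T := 2 * M * Real.exp (θ * α) * ((n + 3).factorial * (2 / δ) ^ (n + 3)) with hT
  have hT0 : 0 < T := by positivity
  have h3_int := integrable_norm_pow_mul_exp_rescaled 3 (half_pos hγ) hs m
  have h2_int := integrable_norm_pow_mul_exp (V := V) 2 hb
  have h0_int := integrable_norm_pow_mul_exp (V := V) 0 hb
  have hpt : ∀ x, (q x - I x) / s ^ 2 * Real.exp (-(I x / s ^ 2)) ≤
      K / s ^ 2 * (‖x - m‖ ^ 3 * Real.exp (-(γ / 2 * ‖x - m‖ ^ 2 / s ^ 2))) +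
      T * s ^ (n + 1) * (‖x‖ ^ 2 * Real.exp (-(a * θ) * ‖x‖ ^ 2) +
        R ^ 2 * (‖x‖ ^ 0 * Real.exp (-(a * θ) * ‖x‖ ^ 2))) := by
    intro x
    by_cases hx : x ∈ Metric.ball m r
    · have h1 := abs_le.mp (hIq x hx)
      have hxr : ‖x - m‖ ≤ r := (mem_ball_iff_norm.mp hx).le
      -- The choice `K r ≤ γ/2` lets the cubic error eat at most half of the quadratic lower bound.
      have h2 : γ / 2 * ‖x - m‖ ^ 2 ≤ I x := by
        have h3 : K * ‖x - m‖ ^ 3 ≤ γ / 2 * ‖x - m‖ ^ 2 := by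
          calc K * ‖x - m‖ ^ 3 = K * ‖x - m‖ * ‖x - m‖ ^ 2 := by ring
            _ ≤ K * r * ‖x - m‖ ^ 2 := by gcongr
            _ ≤ _ := by gcongr
        linarith [hql x]
      refine le_trans ?_ (le_add_of_nonneg_right (by positivity))
      calc (q x - I x) / s ^ 2 * Real.exp (-(I x / s ^ 2))
          ≤ (K * ‖x - m‖ ^ 3) / s ^ 2 * Real.exp (-(γ / 2 * ‖x - m‖ ^ 2 / s ^ 2)) := by
            gcongr
            linarith
        _ = _ := by ring
    · have h1 := hIδ x hx
      refine le_trans ?_ (le_add_of_nonneg_left (by positivity))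
      have h2 : Real.exp (-(I x / s ^ 2)) ≤ Real.exp (θ * α) * Real.exp (-(δ / (2 * s ^ 2))) *
          Real.exp (-(a * θ) * ‖x‖ ^ 2) := by
        rw [← Real.exp_add, ← Real.exp_add, Real.exp_le_exp]
        exact potential_ge_interpolated hδ hc (by positivity) h1 (hI x)
      have h3 : ‖x - m‖ ^ 2 ≤ 2 * (‖x‖ ^ 2 + R ^ 2) := by
        have h4 : ‖x - m‖ ≤ ‖x‖ + R := (norm_sub_le _ _).trans (by gcongr)
        nlinarith [norm_nonneg (x - m), sq_nonneg (‖x‖ - R)]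
      -- Only an upper bound is sought, so `I ≥ δ > 0` may be dropped here, and no upper bound on
      -- the potential far from `m` is required.
      have h4 : q x - I x ≤ M * (2 * (‖x‖ ^ 2 + R ^ 2)) := by
        have : M * ‖x - m‖ ^ 2 ≤ M * (2 * (‖x‖ ^ 2 + R ^ 2)) := by gcongr
        linarith [hqu x]
      calc (q x - I x) / s ^ 2 * Real.exp (-(I x / s ^ 2))
          ≤ (M * (2 * (‖x‖ ^ 2 + R ^ 2))) / s ^ 2 * (Real.exp (θ * α) *
            Real.exp (-(δ / (2 * s ^ 2))) * Real.exp (-(a * θ) * ‖x‖ ^ 2)) := by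
            gcongr
        _ = (2 * M * Real.exp (θ * α)) * (Real.exp (-(δ / (2 * s ^ 2))) / s ^ 2) *
            ((‖x‖ ^ 2 + R ^ 2) * Real.exp (-(a * θ) * ‖x‖ ^ 2)) := by ring
        _ ≤ (2 * M * Real.exp (θ * α)) *
            ((n + 3).factorial * (2 / δ) ^ (n + 3) * s ^ (n + 1)) *
            ((‖x‖ ^ 2 + R ^ 2) * Real.exp (-(a * θ) * ‖x‖ ^ 2)) := by
            gcongr
            exact exp_neg_div_sq_le_pow n hδ hs hs1
        _ = _ := by rw [hT]; ring
  have htail_int : Integrable fun x : V => T * s ^ (n + 1) *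
      (‖x‖ ^ 2 * Real.exp (-(a * θ) * ‖x‖ ^ 2) +
        R ^ 2 * (‖x‖ ^ 0 * Real.exp (-(a * θ) * ‖x‖ ^ 2))) :=
    (h2_int.add (h0_int.const_mul _)).const_mul _
  refine (integral_mono hint ((h3_int.const_mul _).add htail_int) hpt).trans (le_of_eq ?_)
  simp only [Pi.add_apply]
  rw [integral_add (h3_int.const_mul _) htail_int,
    integral_const_mul, integral_const_mul, integral_add h2_int (h0_int.const_mul _),
    integral_const_mul, integral_norm_pow_mul_exp_rescaled 3 (γ / 2) hs m]
  change K / s ^ 2 * (s ^ (n + 3) * _) + T * s ^ (n + 1) * (gaussMoment V 2 (a * θ) +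
    R ^ 2 * gaussMoment V 0 (a * θ)) = _
  rw [pow_add s n 3, pow_add s n 1]
  field_simp

/-- Quantitative Laplace estimate: the divergence of the density `exp (-I / ε)` from its Gaussian
approximation `exp (-q / ε)`, `ε = s ^ 2`, is `O(s)`, uniformly over potentials with common
constants. -/
theorem exists_laplace_bound {γ M K r δ c a α R : ℝ} (hγ : 0 < γ) (hM : 0 < M) (hK : 0 < K)
    (hr : 0 < r) (hKr : K * r ≤ γ / 2) (hδ : 0 < δ) (hc : 0 ≤ c) (ha : 0 < a) :
    ∃ C s₀ : ℝ, 0 < s₀ ∧ ∀ (s : ℝ) (I q : V → ℝ) (m : V), 0 < s → s ≤ s₀ → Continuous I →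
      Continuous q → ‖m‖ ≤ R →
      (∀ x, γ * ‖x - m‖ ^ 2 ≤ q x) → (∀ x, q x ≤ M * ‖x - m‖ ^ 2) →
      (∀ x ∈ Metric.ball m r, |I x - q x| ≤ K * ‖x - m‖ ^ 3) →
      (∀ x, x ∉ Metric.ball m r → δ ≤ I x) →
      (∀ x, s ^ 2 * (a * ‖x‖ ^ 2 - α) - c ≤ I x) →
      Integrable (fun x => (q x - I x) / s ^ 2 * Real.exp (-(I x / s ^ 2))) →
      (∫ x, Real.exp (-(I x / s ^ 2)))⁻¹ *
          (∫ x, (q x - I x) / s ^ 2 * Real.exp (-(I x / s ^ 2))) +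
        Real.log ((∫ x, Real.exp (-(q x / s ^ 2))) / ∫ x, Real.exp (-(I x / s ^ 2))) ≤ C * s := by
  set n := Module.finrank ℝ V with hn
  set G := gaussMoment V 0 M with hG
  have hG0 : 0 < G := gaussMoment_zero_pos hM
  set C₁ := K * gaussMoment V 3 γ / G with hC₁
  have hC₁0 : 0 ≤ C₁ := div_nonneg (mul_nonneg hK.le (gaussMoment_nonneg _ _)) hG0.le
  obtain ⟨C₂, hC₂⟩ : ∃ C₂, C₂ = K * gaussMoment V 3 (γ / 2) +
        2 * M * Real.exp (δ / (2 * (δ + c)) * α) *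
          ((Module.finrank ℝ V + 3).factorial * (2 / δ) ^ (Module.finrank ℝ V + 3)) *
          (gaussMoment V 2 (a * (δ / (2 * (δ + c)))) +
            R ^ 2 * gaussMoment V 0 (a * (δ / (2 * (δ + c))))) := ⟨_, rfl⟩
  have hC₂0 : 0 ≤ C₂ := by
    have h1 := gaussMoment_nonneg (V := V) 3 (γ / 2)
    have h2 := gaussMoment_nonneg (V := V) 2 (a * (δ / (2 * (δ + c))))
    have h3 := gaussMoment_nonneg (V := V) 0 (a * (δ / (2 * (δ + c))))
    rw [hC₂]
    positivity
  -- The three bounds on `s` serve, in order, the tail estimate, the sign outside the ball, and `C₁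
  -- s ≤ 1/2`, which gives `Z ≥ W/2`.
  refine ⟨2 * C₂ / G + 2 * C₁, min 1 (min √(K * r ^ 3) (1 / (2 * (C₁ + 1)))), by positivity, ?_⟩
  intro s I q m hs hs₀ hIc hqc hm hql hqu hIq hIδ hI hint
  have hs1 : s ≤ 1 := hs₀.trans (min_le_left _ _)
  have hs2 : s ^ 2 ≤ K * r ^ 3 :=
    (Real.le_sqrt hs.le (by positivity)).mp
      (hs₀.trans ((min_le_right _ _).trans (min_le_left _ _)))
  have hs3 : C₁ * s ≤ 1 / 2 := by
    have h : s ≤ 1 / (2 * (C₁ + 1)) := hs₀.trans ((min_le_right _ _).trans (min_le_right _ _))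
    rw [le_div_iff₀ (by positivity)] at h
    nlinarith
  have hfint := integrable_exp_neg_div hIc (pow_pos hs 2) ha hI
  obtain ⟨hA, hB⟩ := integral_gaussian_mul_le_integral hγ hM hK hr hs hs2 hqc hql hqu hIq hfint
  have hD := integral_remainder_le hγ hM hK hKr hδ hc ha hs hs1 hm hql hqu hIq hIδ hI hint
  rw [← hC₂, ← hn] at hD
  rw [← hn, ← hG] at hA
  rw [← hG, ← hC₁] at hB
  generalize ∫ x, Real.exp (-(q x / s ^ 2)) = w at *
  generalize ∫ x, Real.exp (-(I x / s ^ 2)) = z at *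
  generalize ∫ x, (q x - I x) / s ^ 2 * Real.exp (-(I x / s ^ 2)) = y at *
  have hw : 0 < w := lt_of_lt_of_le (by positivity) hA
  have hlog := log_div_le_of_le hw hs3 (by positivity) hB
  have hz : s ^ n * G / 2 ≤ z := by nlinarith
  have hz0 : 0 < z := lt_of_lt_of_le (by positivity) hz
  have h1 : z⁻¹ * y ≤ 2 * C₂ / G * s := by
    rw [inv_mul_le_iff₀ hz0]
    calc y ≤ C₂ * s ^ (n + 1) := hD
      _ = s ^ n * G / 2 * (2 * C₂ / G * s) := by field_simp; ring
      _ ≤ _ := by gcongr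
  linarith

end LaplaceEstimate

/-! ### Taylor expansion along a segment -/

section Taylor

variable {V : Type*} [NormedAddCommGroup V] [NormedSpace ℝ V]

/-- Second order Taylor expansion with a bound on the remainder. -/
lemma abs_sub_taylor_two_le {f : V → ℝ} (hf : ContDiff ℝ 3 f) (m v : V) {K : ℝ}
    (hK : ∀ t ∈ Set.Ioo (0 : ℝ) 1, ‖iteratedFDeriv ℝ 3 f (m + t • v)‖ ≤ K) :
    |f (m + v) - (f m + fderiv ℝ f m v + 1 / 2 * iteratedFDeriv ℝ 2 f m (fun _ => v))| ≤
      K * ‖v‖ ^ 3 := by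
  set L : ℝ → V := fun t => m + t • v with hL
  have hLc : ContDiff ℝ 3 L := by fun_prop
  have hL1 : ∀ t, HasDerivAt L v t := fun t => by
    simpa [hL] using ((hasDerivAt_id t).smul_const v).const_add m
  have hL1' : deriv L = fun _ => v := funext fun t => (hL1 t).deriv
  have hL2 : ∀ t, iteratedDeriv 2 L t = 0 := fun t => by
    rw [iteratedDeriv_succ', hL1']; simp [iteratedDeriv_const]
  have hL3 : ∀ t, iteratedDeriv 3 L t = 0 := fun t => by
    rw [iteratedDeriv_succ', hL1']; simp [iteratedDeriv_const]
  have hg : ContDiff ℝ 3 (f ∘ L) := hf.comp hLc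
  have hg0 : (f ∘ L) 0 = f m := by simp [hL]
  have hg1 : (f ∘ L) 1 = f (m + v) := by simp [hL]
  have hd1 : iteratedDeriv 1 (f ∘ L) 0 = fderiv ℝ f m v := by
    rw [iteratedDeriv_one]
    have h := ((hf.differentiable (by norm_num)) (L 0)).hasFDerivAt.comp_hasDerivAt 0 (hL1 0)
    rw [h.deriv]
    simp [hL]
  have hd2 : iteratedDeriv 2 (f ∘ L) 0 = iteratedFDeriv ℝ 2 f m (fun _ => v) := by
    rw [iteratedDeriv_vcomp_two (hf.of_le (by norm_num)).contDiffAt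
      (hLc.of_le (by norm_num)).contDiffAt, hL2, (hL1 0).deriv]
    simp [hL]
  -- `L` is affine, so every chain rule term containing a higher derivative of `L` vanishes.
  have hd3 : ∀ t, iteratedDeriv 3 (f ∘ L) t = iteratedFDeriv ℝ 3 f (L t) (fun _ => v) := fun t => by
    rw [iteratedDeriv_vcomp_three hf.contDiffAt hLc.contDiffAt, hL2, hL3, (hL1 t).deriv,
      (iteratedFDeriv ℝ 2 f (L t)).map_coord_zero 0 (by simp),
      (iteratedFDeriv ℝ 2 f (L t)).map_coord_zero 1 (by simp)]
    simp
  obtain ⟨t, ht, hrem⟩ := taylor_mean_remainder_lagrange_iteratedDeriv (f := f ∘ L) (x := 1)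
    (x₀ := 0) (n := 2) (by norm_num) (by exact_mod_cast hg.contDiffOn)
  have hu : UniqueDiffOn ℝ (Set.uIcc (0 : ℝ) 1) := uniqueDiffOn_uIcc (by norm_num)
  have h0 : (0 : ℝ) ∈ Set.uIcc (0 : ℝ) 1 := by simp
  have htaylor : taylorWithinEval (f ∘ L) 2 (Set.uIcc 0 1) 0 1 =
      f m + fderiv ℝ f m v + 1 / 2 * iteratedFDeriv ℝ 2 f m (fun _ => v) := by
    rw [taylorWithinEval_succ, taylorWithinEval_succ, taylor_within_zero_eval,
      iteratedDerivWithin_eq_iteratedDeriv hu (hg.of_le (by norm_num)).contDiffAt h0,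
      iteratedDerivWithin_eq_iteratedDeriv hu (hg.of_le (by norm_num)).contDiffAt h0, hg0, hd1, hd2]
    norm_num
  rw [htaylor, hg1] at hrem
  rw [hrem, hd3]
  rw [Set.uIoo_of_le zero_le_one] at ht
  have h1 : |iteratedFDeriv ℝ 3 f (L t) (fun _ => v)| ≤ K * ‖v‖ ^ 3 := by
    refine ((iteratedFDeriv ℝ 3 f (L t)).le_opNorm _).trans ?_
    simp only [Finset.prod_const, Finset.card_univ, Fintype.card_fin]
    gcongr
    exact hK t ht
  -- The factor `1/3!` of the Lagrange remainder is simply discarded.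
  norm_num [abs_div]
  have h2 : 0 ≤ K * ‖v‖ ^ 3 := (abs_nonneg _).trans h1
  rw [div_le_iff₀ (by norm_num [Nat.factorial])]
  linarith

end Taylor

/-! ### Hessians and quadratic forms -/

section Hessian

variable {d : ℕ}

lemma dotProduct_hessian_mulVec {f : EuclideanSpace ℝ (Fin d) → ℝ}
    (x v : EuclideanSpace ℝ (Fin d)) :
    (fun i => v i) ⬝ᵥ (hessian f x).mulVec (fun i => v i) =
      iteratedFDeriv ℝ 2 f x (fun _ => v) := by
  have hv : v = ∑ i, v i • EuclideanSpace.single i (1 : ℝ) := by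
    ext j
    simp [Finset.sum_apply, Pi.single_apply]
  rw [iteratedFDeriv_two_apply]
  conv_rhs => rw [hv]
  simp only [map_sum, map_smul, sum_apply, smul_apply,
    smul_eq_mul, dotProduct, Matrix.mulVec, hessian, Matrix.of_apply, iteratedFDeriv_two_apply,
    Matrix.cons_val_zero, Matrix.cons_val_one]
  simp only [Finset.mul_sum]
  rw [Finset.sum_comm]
  refine Finset.sum_congr rfl fun i _ => Finset.sum_congr rfl fun j _ => ?_
  ring

lemma abs_dotProduct_mulVec_le (A : Matrix (Fin d) (Fin d) ℝ) (v : EuclideanSpace ℝ (Fin d)) :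
    |(fun i => v i) ⬝ᵥ A.mulVec (fun i => v i)| ≤ (∑ i, ∑ j, |A i j|) * ‖v‖ ^ 2 := by
  have hv : ∀ i, |v i| ≤ ‖v‖ := fun i => by simpa using PiLp.norm_apply_le v i
  simp only [dotProduct, Matrix.mulVec, Finset.mul_sum, Finset.sum_mul]
  refine (Finset.abs_sum_le_sum_abs _ _).trans (Finset.sum_le_sum fun i _ =>
    (Finset.abs_sum_le_sum_abs _ _).trans (Finset.sum_le_sum fun j _ => ?_))
  rw [abs_mul, abs_mul]
  calc |v i| * (|A i j| * |v j|) ≤ ‖v‖ * (|A i j| * ‖v‖) := by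
        gcongr
        · exact hv i
        · exact hv j
    _ = _ := by ring

/-- The minimum over the compact unit sphere is positive, and homogeneity extends it. For `d = 0`
the sphere is empty and any constant works. -/
lemma exists_le_dotProduct_mulVec_of_posDef {A : Matrix (Fin d) (Fin d) ℝ} (hA : A.PosDef) :
    ∃ γ : ℝ, 0 < γ ∧ ∀ v : EuclideanSpace ℝ (Fin d),
      γ * ‖v‖ ^ 2 ≤ (fun i => v i) ⬝ᵥ A.mulVec (fun i => v i) := by
  set Q : EuclideanSpace ℝ (Fin d) → ℝ := fun v => (fun i => v i) ⬝ᵥ A.mulVec (fun i => v i)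
    with hQ
  have hQc : Continuous Q := by
    simp only [hQ, dotProduct, Matrix.mulVec]
    fun_prop
  have hQpos : ∀ v, v ≠ 0 → 0 < Q v := fun v hv => by
    have h := hA.dotProduct_mulVec_pos (x := fun i => v i) (by
      intro h; apply hv; ext i; exact congrFun h i)
    simpa [hQ] using h
  have hQsmul : ∀ (t : ℝ) v, Q (t • v) = t ^ 2 * Q v := fun t v => by
    simp only [hQ, dotProduct, Matrix.mulVec, PiLp.smul_apply, smul_eq_mul, Finset.mul_sum]
    refine Finset.sum_congr rfl fun i _ => Finset.sum_congr rfl fun j _ => ?_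
    ring
  obtain ⟨γ, hγ, hγQ⟩ : ∃ γ : ℝ, 0 < γ ∧
      ∀ v ∈ Metric.sphere (0 : EuclideanSpace ℝ (Fin d)) 1, γ ≤ Q v := by
    rcases (Metric.sphere (0 : EuclideanSpace ℝ (Fin d)) 1).eq_empty_or_nonempty with h | h
    · exact ⟨1, one_pos, by simp [h]⟩
    · obtain ⟨w, hw, hmin⟩ := (isCompact_sphere (0 : EuclideanSpace ℝ (Fin d)) 1).exists_isMinOn h
        hQc.continuousOn
      refine ⟨Q w, hQpos w ?_, fun v hv => hmin hv⟩
      rintro rfl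
      simp at hw
  refine ⟨γ, hγ, fun v => ?_⟩
  rcases eq_or_ne v 0 with rfl | hv
  · simp
  · have hn : 0 < ‖v‖ := norm_pos_iff.mpr hv
    have h1 := hγQ (‖v‖⁻¹ • v) (by simp [norm_smul, hn.ne'])
    rw [hQsmul, inv_pow, ← div_eq_inv_mul, le_div_iff₀ (by positivity)] at h1
    exact h1

/-- Uniform two-sided bounds for the quadratic forms of matrices converging to a positive definite
one. -/
lemma eventually_quadratic_bounds {ι : Type*} {l : Filter ι}
    {A : ι → Matrix (Fin d) (Fin d) ℝ} {B : Matrix (Fin d) (Fin d) ℝ} (hB : B.PosDef)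
    (hA : Tendsto A l (𝓝 B)) :
    ∃ γ M : ℝ, 0 < γ ∧ 0 < M ∧ ∀ᶠ i in l, ∀ v : EuclideanSpace ℝ (Fin d),
      γ * ‖v‖ ^ 2 ≤ (fun j => v j) ⬝ᵥ (A i).mulVec (fun j => v j) ∧
      (fun j => v j) ⬝ᵥ (A i).mulVec (fun j => v j) ≤ M * ‖v‖ ^ 2 := by
  obtain ⟨γ, hγ, hγB⟩ := exists_le_dotProduct_mulVec_of_posDef hB
  -- Taken at `C = B` for closeness to the limit (lower bound) and at `C = 0` for boundedness (upper
  -- bound).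
  have hsum : ∀ C : Matrix (Fin d) (Fin d) ℝ,
      Tendsto (fun i => ∑ j, ∑ k, |(A i - C) j k|) l (𝓝 (∑ j, ∑ k, |(B - C) j k|)) := fun C => by
    refine tendsto_finsetSum _ fun j _ => tendsto_finsetSum _ fun k _ => ?_
    have h1 : Tendsto (fun i => A i j k) l (𝓝 (B j k)) :=
      ((continuous_apply_apply j k).tendsto B).comp hA
    simpa using (h1.sub_const (C j k)).abs
  have h1 := hsum B
  have h2 := hsum 0
  simp only [sub_self, Matrix.zero_apply, abs_zero, Finset.sum_const_zero, sub_zero] at h1 h2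
  have hM : 0 ≤ ∑ j, ∑ k, |B j k| := by positivity
  refine ⟨γ / 2, ∑ j, ∑ k, |B j k| + 1, by positivity, by positivity, ?_⟩
  filter_upwards [h1.eventually_le_const (half_pos hγ), h2.eventually_le_const (lt_add_one _)]
    with i hi1 hi2 v
  constructor
  · have h3 := neg_le_of_abs_le (abs_dotProduct_mulVec_le (A i - B) v)
    rw [Matrix.sub_mulVec, dotProduct_sub] at h3
    have h4 : (∑ j, ∑ k, |(A i - B) j k|) * ‖v‖ ^ 2 ≤ γ / 2 * ‖v‖ ^ 2 := by gcongr
    linarith [hγB v]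
  · refine (le_abs_self _).trans ((abs_dotProduct_mulVec_le (A i) v).trans ?_)
    gcongr

lemma hessian_sub_const_mul {f g : EuclideanSpace ℝ (Fin d) → ℝ} (hf : ContDiff ℝ 2 f)
    (hg : ContDiff ℝ 2 g) (c : ℝ) (x : EuclideanSpace ℝ (Fin d)) :
    hessian (fun z => f z - c * g z) x = hessian f x - c • hessian g x := by
  have h := iteratedFDeriv_sub_apply (𝕜 := ℝ) (i := 2) (x := x) (f := f) (g := c • g)
    hf.contDiffAt (hg.const_smul c).contDiffAt
  have h' := iteratedFDeriv_const_smul_apply (𝕜 := ℝ) (i := 2) (a := c) (x := x) (f := g)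
    hg.contDiffAt
  have hfun : (fun z => f z - c * g z) = f - c • g := by ext z; simp
  ext i j
  simp only [hessian, Matrix.of_apply, Matrix.sub_apply, Matrix.smul_apply]
  rw [hfun, h, h']
  rfl

lemma norm_iteratedFDeriv_sub_const_mul_le {f g : EuclideanSpace ℝ (Fin d) → ℝ} {n : ℕ}
    (hf : ContDiff ℝ n f) (hg : ContDiff ℝ n g) (c : ℝ) (x : EuclideanSpace ℝ (Fin d)) :
    ‖iteratedFDeriv ℝ n (fun z => f z - c * g z) x‖ ≤
      ‖iteratedFDeriv ℝ n f x‖ + |c| * ‖iteratedFDeriv ℝ n g x‖ := by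
  have h := iteratedFDeriv_sub_apply (𝕜 := ℝ) (i := n) (x := x) (f := f) (g := c • g)
    hf.contDiffAt (hg.const_smul c).contDiffAt
  have h' := iteratedFDeriv_const_smul_apply (𝕜 := ℝ) (i := n) (a := c) (x := x) (f := g)
    hg.contDiffAt
  have hfun : (fun z => f z - c * g z) = f - c • g := by ext z; simp
  rw [hfun, h, h']
  refine (norm_sub_le _ _).trans ?_
  rw [norm_smul, Real.norm_eq_abs]

lemma continuous_hessian {f : EuclideanSpace ℝ (Fin d) → ℝ} (hf : ContDiff ℝ 2 f) :
    Continuous (hessian f) := by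
  refine continuous_matrix fun i j => ?_
  have h := hf.continuous_iteratedFDeriv (m := 2) le_rfl
  simp only [hessian, Matrix.of_apply]
  fun_prop

end Hessian

/-! ### Densities and divergences of the posterior at fixed `ε` -/

section Posterior

variable {d : ℕ}

/-- Half the quadratic form of the Hessian of `I_ε` at `m`, centered at `m`. -/
noncomputable def quadApprox (prior φ : EuclideanSpace ℝ (Fin d) → ℝ) (ε : ℝ)
    (m x : EuclideanSpace ℝ (Fin d)) : ℝ :=
  1 / 2 * ((fun i => (x - m) i) ⬝ᵥ
    (hessian (regPotential prior φ ε) m).mulVec (fun i => (x - m) i))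

/-- The conditions at a fixed `ε` under which the posterior and its Laplace approximation have
positive continuous densities and finite divergences. -/
structure IsRegularPosterior (prior φ : EuclideanSpace ℝ (Fin d) → ℝ) (ε c : ℝ)
    (m : EuclideanSpace ℝ (Fin d)) : Prop where
  isPriorDensity : IsPriorDensity prior
  continuous_prior : Continuous prior
  continuous_potential : Continuous φ
  eps_pos : 0 < ε
  neg_le_potential : ∀ x, -c ≤ φ x
  regPotential_nonneg : ∀ x, 0 ≤ regPotential prior φ ε x
  hessian_posDef : (hessian (regPotential prior φ ε) m).PosDef

lemma continuous_quadApprox (prior φ : EuclideanSpace ℝ (Fin d) → ℝ) (ε : ℝ)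
    (m : EuclideanSpace ℝ (Fin d)) : Continuous (quadApprox prior φ ε m) := by
  unfold quadApprox
  simp only [dotProduct, Matrix.mulVec]
  fun_prop

lemma IsPriorDensity.exists_log_le {prior : EuclideanSpace ℝ (Fin d) → ℝ}
    (h : IsPriorDensity prior) :
    ∃ a α : ℝ, 0 < a ∧ ∀ x, Real.log (prior x) ≤ α - a * ‖x‖ ^ 2 := by
  obtain ⟨A, a, ha, hA⟩ := h.gaussian_tail
  have hA0 : 0 < A := by
    have h1 := (h.pos 0).trans_le (hA 0)
    simpa using h1
  refine ⟨a, Real.log A, ha, fun x => ?_⟩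
  have h1 := Real.log_le_log (h.pos x) (hA x)
  rw [Real.log_mul hA0.ne' (Real.exp_pos _).ne', Real.log_exp] at h1
  linarith

/-- The quadratic growth comes only from the prior and has coefficient `εa`; after division by `ε`
it is a fixed Gaussian decay. -/
lemma regPotential_growth {prior φ : EuclideanSpace ℝ (Fin d) → ℝ} {ε c a α : ℝ} (hε : 0 < ε)
    (hα : ∀ x, Real.log (prior x) ≤ α - a * ‖x‖ ^ 2) (hc : ∀ x, -c ≤ φ x)
    (x : EuclideanSpace ℝ (Fin d)) :
    ε * (a * ‖x‖ ^ 2 - α) - c ≤ regPotential prior φ ε x := by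
  have h1 := mul_le_mul_of_nonneg_left (hα x) hε.le
  have h2 := hc x
  unfold regPotential
  linarith

lemma IsPriorDensity.integrable {prior : EuclideanSpace ℝ (Fin d) → ℝ}
    (h : IsPriorDensity prior) : Integrable prior :=
  Integrable.of_integral_ne_zero (by rw [h.integral_eq_one]; exact one_ne_zero)

lemma IsPriorDensity.isProbabilityMeasure {prior : EuclideanSpace ℝ (Fin d) → ℝ}
    (h : IsPriorDensity prior) : IsProbabilityMeasure (priorMeasure prior) := by
  refine ⟨?_⟩
  rw [priorMeasure, withDensity_apply _ MeasurableSet.univ, Measure.restrict_univ,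
    ← ofReal_integral_eq_lintegral_ofReal h.integrable (ae_of_all _ fun x => (h.pos x).le),
    h.integral_eq_one, ENNReal.ofReal_one]

lemma integrable_withDensity_ofReal_iff {p g : EuclideanSpace ℝ (Fin d) → ℝ} (hp : Measurable p)
    (hp0 : ∀ x, 0 ≤ p x) :
    Integrable g (volume.withDensity fun x => ENNReal.ofReal (p x)) ↔
      Integrable fun x => g x * p x := by
  rw [integrable_withDensity_iff (by fun_prop) (by simp)]
  simp_rw [ENNReal.toReal_ofReal (hp0 _)]

lemma integral_withDensity_ofReal {p : EuclideanSpace ℝ (Fin d) → ℝ} (hp : Measurable p)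
    (hp0 : ∀ x, 0 ≤ p x) (g : EuclideanSpace ℝ (Fin d) → ℝ) :
    ∫ x, g x ∂(volume.withDensity fun x => ENNReal.ofReal (p x)) = ∫ x, g x * p x := by
  rw [integral_withDensity_eq_integral_toReal_smul (by fun_prop) (by simp)]
  simp_rw [ENNReal.toReal_ofReal (hp0 _), smul_eq_mul, mul_comm]

lemma prior_mul_exp_eq {prior φ : EuclideanSpace ℝ (Fin d) → ℝ} (hpos : ∀ x, 0 < prior x) {ε : ℝ}
    (hε : 0 < ε) (x : EuclideanSpace ℝ (Fin d)) :
    prior x * Real.exp (-(1 / ε) * φ x) = Real.exp (-(regPotential prior φ ε x / ε)) := by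
  nth_rw 1 [← Real.exp_log (hpos x)]
  rw [← Real.exp_add, regPotential]
  congr 1
  field_simp
  ring

namespace IsRegularPosterior

variable {prior φ : EuclideanSpace ℝ (Fin d) → ℝ} {ε c : ℝ} {m : EuclideanSpace ℝ (Fin d)}

lemma continuous_regPotential (h : IsRegularPosterior prior φ ε c m) :
    Continuous (regPotential prior φ ε) :=
  h.continuous_potential.sub
    (continuous_const.mul (h.continuous_prior.log fun x => (h.isPriorDensity.pos x).ne'))

lemma integrable_exp (h : IsRegularPosterior prior φ ε c m) :
    Integrable fun x => Real.exp (-(regPotential prior φ ε x / ε)) := by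
  obtain ⟨a, α, ha, hα⟩ := h.isPriorDensity.exists_log_le
  exact integrable_exp_neg_div h.continuous_regPotential h.eps_pos ha
    (regPotential_growth h.eps_pos hα h.neg_le_potential)

lemma integral_exp_pos (h : IsRegularPosterior prior φ ε c m) :
    0 < ∫ x, Real.exp (-(regPotential prior φ ε x / ε)) :=
  MeasureTheory.integral_exp_pos h.integrable_exp

lemma posterior_eq (h : IsRegularPosterior prior φ ε c m) :
    posterior prior φ ε = volume.withDensity fun x => ENNReal.ofReal
      ((∫ y, Real.exp (-(regPotential prior φ ε y / ε)))⁻¹ *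
        Real.exp (-(regPotential prior φ ε x / ε))) := by
  have hpm := h.continuous_prior.measurable
  have hφm := h.continuous_potential.measurable
  have hZ : ∫ x, Real.exp (-(1 / ε) * φ x) ∂(priorMeasure prior) =
      ∫ y, Real.exp (-(regPotential prior φ ε y / ε)) := by
    rw [priorMeasure, integral_withDensity_ofReal hpm fun x => (h.isPriorDensity.pos x).le]
    simp_rw [mul_comm _ (prior _), prior_mul_exp_eq h.isPriorDensity.pos h.eps_pos]
  rw [posterior, Measure.tilted, hZ, priorMeasure, ← withDensity_mul _ (by fun_prop) (by fun_prop)]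
  congr 1
  ext x
  rw [Pi.mul_apply, ← ENNReal.ofReal_mul (h.isPriorDensity.pos x).le, ← mul_div_assoc,
    prior_mul_exp_eq h.isPriorDensity.pos h.eps_pos, div_eq_inv_mul]

lemma isProbabilityMeasure_posterior (h : IsRegularPosterior prior φ ε c m) :
    IsProbabilityMeasure (posterior prior φ ε) := by
  have := h.isPriorDensity.isProbabilityMeasure
  refine isProbabilityMeasure_tilted ?_
  rw [priorMeasure, integrable_withDensity_ofReal_iff h.continuous_prior.measurable
    fun x => (h.isPriorDensity.pos x).le]
  simp_rw [mul_comm _ (prior _), prior_mul_exp_eq h.isPriorDensity.pos h.eps_pos]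
  exact h.integrable_exp

lemma integrable_posterior_iff (h : IsRegularPosterior prior φ ε c m)
    {g : EuclideanSpace ℝ (Fin d) → ℝ} :
    Integrable g (posterior prior φ ε) ↔
      Integrable fun x => g x * Real.exp (-(regPotential prior φ ε x / ε)) := by
  have := h.continuous_regPotential
  have hZ := h.integral_exp_pos
  rw [h.posterior_eq, integrable_withDensity_ofReal_iff (by fun_prop) fun x => by positivity]
  simp_rw [mul_left_comm (g _)]
  exact integrable_const_mul_iff (inv_ne_zero hZ.ne').isUnit _

lemma integral_posterior (h : IsRegularPosterior prior φ ε c m)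
    (g : EuclideanSpace ℝ (Fin d) → ℝ) :
    ∫ x, g x ∂(posterior prior φ ε) = (∫ x, Real.exp (-(regPotential prior φ ε x / ε)))⁻¹ *
      ∫ x, g x * Real.exp (-(regPotential prior φ ε x / ε)) := by
  have := h.continuous_regPotential
  have hZ := h.integral_exp_pos
  rw [h.posterior_eq, integral_withDensity_ofReal (by fun_prop) fun x => by positivity]
  simp_rw [mul_left_comm (g _)]
  rw [integral_const_mul]

/-- The determinant need not be computed: the density is a constant times the exponential and
integrates to one. -/
lemma laplaceDensity_eq (h : IsRegularPosterior prior φ ε c m) (x : EuclideanSpace ℝ (Fin d)) :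
    laplaceDensity prior φ ε m x = (∫ y, Real.exp (-(quadApprox prior φ ε m y / ε)))⁻¹ *
      Real.exp (-(quadApprox prior φ ε m x / ε)) := by
  obtain ⟨k, hk⟩ : ∃ k : ℝ, ∀ y, laplaceDensity prior φ ε m y =
      k * Real.exp (-(quadApprox prior φ ε m y / ε)) := by
    refine ⟨(ε ^ ((d : ℝ) / 2) * √(((2 * Real.pi) • laplaceCov prior φ ε m).det))⁻¹,
      fun y => ?_⟩
    rw [laplaceDensity, quadApprox]
    congr 2
    have := h.eps_pos
    field_simp
  have hpos := laplaceDensity_pos h.eps_pos h.hessian_posDef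
  have hcont : Continuous (laplaceDensity prior φ ε m) := by
    have := continuous_quadApprox prior φ ε m
    rw [funext hk]
    fun_prop
  have hprob : IsProbabilityMeasure (laplaceApprox prior φ ε m) := by
    unfold laplaceApprox; infer_instance
  have h1 : ∫ y, laplaceDensity prior φ ε m y = 1 := by
    have h2 := integral_withDensity_ofReal hcont.measurable (fun x => (hpos x).le) fun _ => 1
    rw [← laplaceApprox_eq_withDensity h.eps_pos h.hessian_posDef] at h2
    simpa using h2.symm
  simp_rw [hk] at h1 ⊢
  rw [integral_const_mul] at h1
  rw [eq_inv_of_mul_eq_one_left h1]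

lemma exists_abs_quadApprox_le (prior φ : EuclideanSpace ℝ (Fin d) → ℝ) (ε : ℝ)
    (m : EuclideanSpace ℝ (Fin d)) :
    ∃ M : ℝ, ∀ x, |quadApprox prior φ ε m x| ≤ M * ‖x - m‖ ^ 2 := by
  refine ⟨1 / 2 * ∑ i, ∑ j, |hessian (regPotential prior φ ε) m i j|, fun x => ?_⟩
  rw [quadApprox, abs_mul, abs_of_pos (by norm_num : (0 : ℝ) < 1 / 2), mul_assoc]
  gcongr
  exact abs_dotProduct_mulVec_le _ _

lemma integrable_remainder (h : IsRegularPosterior prior φ ε c m) :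
    Integrable fun x => (quadApprox prior φ ε m x - regPotential prior φ ε x) / ε *
      Real.exp (-(regPotential prior φ ε x / ε)) := by
  obtain ⟨a, α, ha, hα⟩ := h.isPriorDensity.exists_log_le
  have hg := regPotential_growth h.eps_pos hα h.neg_le_potential
  obtain ⟨M, hM⟩ := exists_abs_quadApprox_le prior φ ε m
  have h1 := integrable_mul_exp_neg_div_of_le_sq h.continuous_regPotential
    (continuous_quadApprox prior φ ε m) h.eps_pos ha hg hM
  have h2 := integrable_self_mul_exp_neg_div h.continuous_regPotential h.eps_pos ha hg
    h.regPotential_nonneg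
  refine ((h1.sub h2).const_mul ε⁻¹).congr (ae_of_all _ fun x => ?_)
  simp only [Pi.sub_apply]
  ring

lemma integral_exp_quadApprox_pos (h : IsRegularPosterior prior φ ε c m) :
    0 < ∫ y, Real.exp (-(quadApprox prior φ ε m y / ε)) := by
  have h1 := laplaceDensity_pos h.eps_pos h.hessian_posDef m
  rw [h.laplaceDensity_eq] at h1
  exact inv_pos.mp (pos_of_mul_pos_left h1 (Real.exp_pos _).le)

lemma log_posterior_div_laplace (h : IsRegularPosterior prior φ ε c m)
    (x : EuclideanSpace ℝ (Fin d)) :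
    Real.log ((∫ y, Real.exp (-(regPotential prior φ ε y / ε)))⁻¹ *
        Real.exp (-(regPotential prior φ ε x / ε)) / laplaceDensity prior φ ε m x) =
      (quadApprox prior φ ε m x - regPotential prior φ ε x) / ε +
        Real.log ((∫ y, Real.exp (-(quadApprox prior φ ε m y / ε))) /
          ∫ y, Real.exp (-(regPotential prior φ ε y / ε))) := by
  have hZ := h.integral_exp_pos
  have hW := h.integral_exp_quadApprox_pos
  rw [h.laplaceDensity_eq, Real.log_div (by positivity) (by positivity),
    Real.log_mul (by positivity) (by positivity), Real.log_mul (by positivity) (by positivity),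
    Real.log_exp, Real.log_exp, Real.log_inv, Real.log_inv, Real.log_div hW.ne' hZ.ne']
  ring

lemma log_posterior_div_prior (h : IsRegularPosterior prior φ ε c m)
    (x : EuclideanSpace ℝ (Fin d)) :
    Real.log ((∫ y, Real.exp (-(regPotential prior φ ε y / ε)))⁻¹ *
        Real.exp (-(regPotential prior φ ε x / ε)) / prior x) =
      -(φ x / ε) - Real.log (∫ y, Real.exp (-(regPotential prior φ ε y / ε))) := by
  have hZ := h.integral_exp_pos
  have hε := h.eps_pos
  rw [Real.log_div (by positivity) (h.isPriorDensity.pos x).ne',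
    Real.log_mul (by positivity) (by positivity), Real.log_exp, Real.log_inv, regPotential]
  field_simp
  ring

lemma integrable_log_posterior_div_laplace (h : IsRegularPosterior prior φ ε c m) :
    Integrable (fun x => Real.log ((∫ y, Real.exp (-(regPotential prior φ ε y / ε)))⁻¹ *
        Real.exp (-(regPotential prior φ ε x / ε)) / laplaceDensity prior φ ε m x))
      (posterior prior φ ε) := by
  have := h.isProbabilityMeasure_posterior
  simp_rw [h.log_posterior_div_laplace]
  exact (h.integrable_posterior_iff.mpr h.integrable_remainder).add (integrable_const _)

lemma integrable_log_posterior_div_prior (h : IsRegularPosterior prior φ ε c m) :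
    Integrable (fun x => Real.log ((∫ y, Real.exp (-(regPotential prior φ ε y / ε)))⁻¹ *
        Real.exp (-(regPotential prior φ ε x / ε)) / prior x)) (posterior prior φ ε) := by
  have := h.isProbabilityMeasure_posterior
  have hε := h.eps_pos
  have hφ := h.continuous_potential
  have hI := h.continuous_regPotential
  simp_rw [h.log_posterior_div_prior]
  refine Integrable.sub (h.integrable_posterior_iff.mpr ?_) (integrable_const _)
  -- With `t = φ/ε ≥ -k`, `k = |c|/ε`, the product `|t| exp (-t)` is at most `1` for `t ≥ 0` and at
  -- most `k exp k` for `t ≤ 0`; the prior itself then dominates.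
  refine (h.isPriorDensity.integrable.const_mul (1 + |c| / ε * Real.exp (|c| / ε))).mono'
    (by fun_prop) (ae_of_all _ fun x => ?_)
  have hp := h.isPriorDensity.pos x
  rw [← prior_mul_exp_eq h.isPriorDensity.pos hε, norm_mul, norm_mul, norm_neg,
    Real.norm_of_nonneg hp.le, Real.norm_of_nonneg (Real.exp_pos _).le, mul_left_comm,
    mul_comm _ (prior x), Real.norm_eq_abs]
  refine mul_le_mul_of_nonneg_left ?_ hp.le
  have he : -(1 / ε) * φ x = -(φ x / ε) := by ring
  rw [he]
  have hc : -(|c| / ε) ≤ φ x / ε := by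
    rw [← neg_div]
    gcongr
    exact (neg_le_neg (le_abs_self c)).trans (h.neg_le_potential x)
  set t := φ x / ε
  have hK : 0 ≤ |c| / ε := by positivity
  set k := |c| / ε
  rcases le_total 0 t with ht | ht
  · rw [abs_of_nonneg ht, Real.exp_neg, ← div_eq_mul_inv]
    have h1 : t / Real.exp t ≤ 1 := by
      rw [div_le_one (Real.exp_pos _)]
      linarith [Real.add_one_le_exp t]
    have h2 : 0 ≤ k * Real.exp k := by positivity
    linarith
  · rw [abs_of_nonpos ht]
    have h1 : -t * Real.exp (-t) ≤ k * Real.exp k := by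
      gcongr <;> linarith
    linarith

lemma measurable_laplaceDensity (h : IsRegularPosterior prior φ ε c m) :
    Measurable (laplaceDensity prior φ ε m) := by
  have := (continuous_quadApprox prior φ ε m).measurable
  rw [funext h.laplaceDensity_eq]
  fun_prop

lemma klDiv_laplaceApprox_ne_top (h : IsRegularPosterior prior φ ε c m) :
    klDiv (posterior prior φ ε) (laplaceApprox prior φ ε m) ≠ ⊤ := by
  have hI := h.continuous_regPotential
  have hZ := h.integral_exp_pos
  have hprob : IsProbabilityMeasure (laplaceApprox prior φ ε m) := by
    unfold laplaceApprox; infer_instance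
  have hint := h.integrable_log_posterior_div_laplace
  rw [h.posterior_eq] at hint ⊢
  rw [laplaceApprox_eq_withDensity h.eps_pos h.hessian_posDef] at hprob ⊢
  exact klDiv_withDensity_ofReal_ne_top (by fun_prop) h.measurable_laplaceDensity
    (fun x => by positivity) (laplaceDensity_pos h.eps_pos h.hessian_posDef) hint

lemma toReal_klDiv_laplaceApprox (h : IsRegularPosterior prior φ ε c m) :
    (klDiv (posterior prior φ ε) (laplaceApprox prior φ ε m)).toReal =
      ∫ x, Real.log ((∫ y, Real.exp (-(regPotential prior φ ε y / ε)))⁻¹ *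
        Real.exp (-(regPotential prior φ ε x / ε)) / laplaceDensity prior φ ε m x)
      ∂(posterior prior φ ε) := by
  have hI := h.continuous_regPotential
  have hZ := h.integral_exp_pos
  have hprob : IsProbabilityMeasure (laplaceApprox prior φ ε m) := by
    unfold laplaceApprox; infer_instance
  have hpost := h.isProbabilityMeasure_posterior
  rw [h.posterior_eq] at hpost ⊢
  rw [laplaceApprox_eq_withDensity h.eps_pos h.hessian_posDef] at hprob ⊢
  exact toReal_klDiv_withDensity_ofReal (by fun_prop) h.measurable_laplaceDensity
    (fun x => by positivity) (laplaceDensity_pos h.eps_pos h.hessian_posDef)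

lemma toReal_klDiv_laplaceApprox_eq (h : IsRegularPosterior prior φ ε c m) :
    (klDiv (posterior prior φ ε) (laplaceApprox prior φ ε m)).toReal =
      (∫ x, Real.exp (-(regPotential prior φ ε x / ε)))⁻¹ *
        (∫ x, (quadApprox prior φ ε m x - regPotential prior φ ε x) / ε *
          Real.exp (-(regPotential prior φ ε x / ε))) +
        Real.log ((∫ x, Real.exp (-(quadApprox prior φ ε m x / ε))) /
          ∫ x, Real.exp (-(regPotential prior φ ε x / ε))) := by
  have := h.isProbabilityMeasure_posterior
  rw [h.toReal_klDiv_laplaceApprox]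
  simp_rw [h.log_posterior_div_laplace]
  rw [integral_add (h.integrable_posterior_iff.mpr h.integrable_remainder) (integrable_const _),
    h.integral_posterior]
  simp

/-- The pointwise identity `log (p/π) - log (p/ℓ) = log (ℓ/π)` is integrated; both terms on the left
are integrable, so the gain's integrand needs no separate treatment. -/
lemma toReal_klDiv_priorMeasure (h : IsRegularPosterior prior φ ε c m) :
    (klDiv (posterior prior φ ε) (priorMeasure prior)).toReal =
      (klDiv (posterior prior φ ε) (laplaceApprox prior φ ε m)).toReal +
        laplaceGain prior φ ε m := by
  have hI := h.continuous_regPotential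
  have hZ := h.integral_exp_pos
  have hprior := h.isPriorDensity.isProbabilityMeasure
  have hpost := h.isProbabilityMeasure_posterior
  have hkl : (klDiv (posterior prior φ ε) (priorMeasure prior)).toReal =
      ∫ x, Real.log ((∫ y, Real.exp (-(regPotential prior φ ε y / ε)))⁻¹ *
        Real.exp (-(regPotential prior φ ε x / ε)) / prior x) ∂(posterior prior φ ε) := by
    rw [h.posterior_eq] at hpost ⊢
    rw [priorMeasure] at hprior ⊢
    exact toReal_klDiv_withDensity_ofReal (by fun_prop) h.continuous_prior.measurable
      (fun x => by positivity) h.isPriorDensity.pos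
  rw [hkl, h.toReal_klDiv_laplaceApprox, laplaceGain, ← sub_eq_iff_eq_add',
    ← integral_sub h.integrable_log_posterior_div_prior h.integrable_log_posterior_div_laplace]
  refine integral_congr_ae (ae_of_all _ fun x => ?_)
  have h1 := laplaceDensity_pos h.eps_pos h.hessian_posDef x
  have h2 := h.isPriorDensity.pos x
  simp only
  rw [Real.log_div (by positivity) h2.ne', Real.log_div (by positivity) h1.ne',
    Real.log_div h1.ne' h2.ne']
  ring

end IsRegularPosterior

end Posterior

/-! ### Uniform constants as `ε ↓ 0` -/

section Asymptotics

variable {d : ℕ} {prior : EuclideanSpace ℝ (Fin d) → ℝ} {ε₀ : ℝ}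
  {Φ : ℝ → EuclideanSpace ℝ (Fin d) → ℝ} {u : ℝ → EuclideanSpace ℝ (Fin d)}

lemma LaplaceAssumption.isRegularPosterior (h : LaplaceAssumption ε₀ prior Φ u)
    (hprior : IsPriorDensity prior) {c : ℝ} (hc : ∀ ε, 0 < ε → ε ≤ ε₀ → ∀ x, -c ≤ Φ ε x)
    {ε : ℝ} (hε : 0 < ε) (hε' : ε ≤ ε₀) : IsRegularPosterior prior (Φ ε) ε c (u ε) where
  isPriorDensity := hprior
  continuous_prior := h.contDiff_prior.continuous
  continuous_potential := (h.contDiff_potential ε hε hε').continuous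
  eps_pos := hε
  neg_le_potential := hc ε hε hε'
  regPotential_nonneg x := by
    rw [← h.min_eq_zero ε hε hε']
    rcases eq_or_ne x (u ε) with rfl | hx
    · exact le_rfl
    · exact (h.unique_min ε hε hε' x hx).le
  hessian_posDef := h.hessian_posDef ε hε hε'

lemma LaplaceAssumption.contDiff_log_prior (h : LaplaceAssumption ε₀ prior Φ u)
    (hprior : IsPriorDensity prior) : ContDiff ℝ 3 fun z => Real.log (prior z) :=
  h.contDiff_prior.log fun x => (hprior.pos x).ne'

lemma LaplaceAssumption.contDiff_regPotential (h : LaplaceAssumption ε₀ prior Φ u)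
    (hprior : IsPriorDensity prior) {ε : ℝ} (hε : 0 < ε) (hε' : ε ≤ ε₀) :
    ContDiff ℝ 3 (regPotential prior (Φ ε) ε) :=
  (h.contDiff_potential ε hε hε').sub (contDiff_const.mul (h.contDiff_log_prior hprior))

/-- The prior contributes `ε` times a Hessian that converges by continuity at the limit of `u ε`, so
the limit is that of the Hessians of `Φ ε`. -/
lemma LaplaceAssumption.exists_tendsto_hessian (h : LaplaceAssumption ε₀ prior Φ u)
    (hprior : IsPriorDensity prior) (hε₀ : 0 < ε₀) :
    ∃ H : Matrix (Fin d) (Fin d) ℝ, H.PosDef ∧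
      Tendsto (fun ε => hessian (regPotential prior (Φ ε) ε) (u ε)) (𝓝[>] 0) (𝓝 H) := by
  obtain ⟨H, hH, hHt⟩ := h.tendsto_hessian
  obtain ⟨v, hv⟩ := h.tendsto_min
  refine ⟨H, hH, ?_⟩
  have hlog : ContDiff ℝ 2 fun z => Real.log (prior z) :=
    (h.contDiff_log_prior hprior).of_le (by norm_num)
  have h1 : Tendsto (fun ε => hessian (fun z => Real.log (prior z)) (u ε)) (𝓝[>] 0)
      (𝓝 (hessian (fun z => Real.log (prior z)) v)) :=
    ((continuous_hessian hlog).tendsto v).comp hv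
  have h2 : Tendsto (fun ε : ℝ => ε) (𝓝[>] 0) (𝓝 0) := tendsto_nhdsWithin_of_tendsto_nhds tendsto_id
  have h3 := hHt.sub (h2.smul h1)
  rw [zero_smul, sub_zero] at h3
  refine h3.congr' ?_
  filter_upwards [Ioc_mem_nhdsGT hε₀] with ε hε
  exact (hessian_sub_const_mul ((h.contDiff_potential ε hε.1 hε.2).of_le (by norm_num)) hlog ε
    (u ε)).symm

lemma LaplaceAssumption.abs_regPotential_sub_quadApprox_le (h : LaplaceAssumption ε₀ prior Φ u)
    (hprior : IsPriorDensity prior) {ε : ℝ} (hε : 0 < ε) (hε' : ε ≤ ε₀) {r K : ℝ}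
    (hK : ∀ y ∈ Metric.ball (u ε) r, ‖iteratedFDeriv ℝ 3 (regPotential prior (Φ ε) ε) y‖ ≤ K)
    {x : EuclideanSpace ℝ (Fin d)} (hx : x ∈ Metric.ball (u ε) r) :
    |regPotential prior (Φ ε) ε x - quadApprox prior (Φ ε) ε (u ε) x| ≤ K * ‖x - u ε‖ ^ 3 := by
  have hgrad : fderiv ℝ (regPotential prior (Φ ε) ε) (u ε) = 0 := by
    have h1 := h.gradient_eq_zero ε hε hε'
    rw [gradient] at h1
    simpa using h1
  have h2 := abs_sub_taylor_two_le (h.contDiff_regPotential hprior hε hε') (u ε) (x - u ε)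
    (K := K) fun t ht => hK _ (by
      rw [mem_ball_iff_norm] at hx ⊢
      rw [add_sub_cancel_left, norm_smul, Real.norm_of_nonneg ht.1.le]
      nlinarith [norm_nonneg (x - u ε), ht.2])
  rw [add_sub_cancel, h.min_eq_zero ε hε hε', hgrad, ← dotProduct_hessian_mulVec] at h2
  simpa [quadApprox] using h2

/-- The divergence of the posterior from its Laplace approximation is `O(√ε)`. -/
theorem exists_toReal_klDiv_le (hprior : IsPriorDensity prior) (hε₀ : 0 < ε₀)
    (hΦ : UniformlyBoundedBelow ε₀ Φ) (h : LaplaceAssumption ε₀ prior Φ u) :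
    ∃ C : ℝ, ∀ᶠ ε in 𝓝[>] (0 : ℝ),
      (klDiv (posterior prior (Φ ε) ε) (laplaceApprox prior (Φ ε) ε (u ε))).toReal ≤ C * √ε := by
  obtain ⟨c, hc⟩ := hΦ
  have hc' : ∀ ε, 0 < ε → ε ≤ ε₀ → ∀ x, -|c| ≤ Φ ε x := fun ε h1 h2 x =>
    (neg_le_neg (le_abs_self c)).trans (hc ε h1 h2 x)
  obtain ⟨a, α, ha, hα⟩ := hprior.exists_log_le
  obtain ⟨v, hv⟩ := h.tendsto_min
  obtain ⟨H, hH, hHt⟩ := h.exists_tendsto_hessian hprior hε₀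
  obtain ⟨γ, M, hγ, hM, hγM⟩ := eventually_quadratic_bounds hH hHt
  -- Used here for the derivative bounds: eventually `‖u ε‖ ≤ ‖v‖ + 1`, and `r ≤ 1`, so this ball
  -- contains the `r`-ball around `u ε`. The second use, at radius `r`, supplies the separation `δ`.
  obtain ⟨ε₁, _, K₀, hε₁, _, hK₀⟩ := h.separation_and_bounds (‖v‖ + 2) (by positivity)
  set K := 2 * |K₀| + 1 with hKdef
  have hK : 0 < K := by positivity
  -- `q` is half the Hessian form, so its lower constant is `γ/2` and the requirement reads `K r ≤
  -- (γ/2)/2`.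
  set r := min 1 (γ / 4 / K) with hrdef
  have hr : 0 < r := by positivity
  have hKr : K * r ≤ γ / 2 / 2 := by
    calc K * r ≤ K * (γ / 4 / K) := by gcongr; exact min_le_right _ _
      _ = γ / 2 / 2 := by field_simp; norm_num
  obtain ⟨ε₂, δ, _, hε₂, hδ, hsep⟩ := h.separation_and_bounds r hr
  obtain ⟨C, s₀, hs₀, hC⟩ := exists_laplace_bound (V := EuclideanSpace ℝ (Fin d)) (α := α)
    (R := ‖v‖ + 1) (half_pos hγ) (half_pos hM) hK hr hKr hδ (abs_nonneg c) ha
  refine ⟨C, ?_⟩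
  have hu : ∀ᶠ ε in 𝓝[>] (0 : ℝ), ‖u ε‖ ≤ ‖v‖ + 1 :=
    hv.norm.eventually_le_const (lt_add_one _)
  filter_upwards [hγM, hu, Ioc_mem_nhdsGT hε₀, Ioc_mem_nhdsGT hε₁, Ioc_mem_nhdsGT hε₂,
    Ioc_mem_nhdsGT one_pos, Ioc_mem_nhdsGT (pow_pos hs₀ 2)] with ε hq hum h0 h1 h2 h3 h4
  have hε : 0 < ε := h0.1
  have hreg := h.isRegularPosterior hprior hc' hε h0.2
  have hsq : √ε ^ 2 = ε := Real.sq_sqrt hε.le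
  have hD3 : ∀ y ∈ Metric.ball (u ε) r,
      ‖iteratedFDeriv ℝ 3 (regPotential prior (Φ ε) ε) y‖ ≤ K := fun y hy => by
    have hy' : y ∈ Metric.closedBall (0 : EuclideanSpace ℝ (Fin d)) (‖v‖ + 2) := by
      rw [mem_closedBall_zero_iff]
      have h5 : ‖y - u ε‖ < r := mem_ball_iff_norm.mp hy
      have h6 : r ≤ 1 := min_le_left _ _
      have h7 : ‖y‖ ≤ ‖y - u ε‖ + ‖u ε‖ := by simpa using norm_add_le (y - u ε) (u ε)
      linarith
    obtain ⟨h5, h6⟩ := (hK₀ ε hε h1.2).2 y hy'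
    refine (norm_iteratedFDeriv_sub_const_mul_le (n := 3) (h.contDiff_potential ε hε h0.2)
      (h.contDiff_log_prior hprior) ε y).trans ?_
    rw [abs_of_pos hε]
    have h7 : ε * ‖iteratedFDeriv ℝ 3 (fun z => Real.log (prior z)) y‖ ≤ 1 * |K₀| := by
      gcongr
      · exact h3.2
      · exact h5.trans (le_abs_self _)
    linarith [le_abs_self K₀]
  have hfinal := hC √ε (regPotential prior (Φ ε) ε) (quadApprox prior (Φ ε) ε (u ε)) (u ε)
    (Real.sqrt_pos.mpr hε) (Real.sqrt_le_iff.mpr ⟨hs₀.le, h4.2⟩) hreg.continuous_regPotential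
    (continuous_quadApprox _ _ _ _) hum
    (fun x => by have := (hq (x - u ε)).1; unfold quadApprox; linarith)
    (fun x => by have := (hq (x - u ε)).2; unfold quadApprox; linarith)
    (fun x hx => h.abs_regPotential_sub_quadApprox_le hprior hε h0.2 hD3 hx)
    (hsep ε hε h2.2).1
    (by rw [hsq]; exact regPotential_growth hε hα (hc' ε hε h0.2))
    (by rw [hsq]; exact hreg.integrable_remainder)
  rw [hsq] at hfinal
  rw [hreg.toReal_klDiv_laplaceApprox_eq]
  exact hfinal

theorem klDiv_isBigO (hprior : IsPriorDensity prior) (hε₀ : 0 < ε₀)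
    (hΦ : UniformlyBoundedBelow ε₀ Φ) (h : LaplaceAssumption ε₀ prior Φ u) :
    (fun ε : ℝ => (klDiv (posterior prior (Φ ε) ε)
      (laplaceApprox prior (Φ ε) ε (u ε))).toReal)
        =O[𝓝[>] (0 : ℝ)] (fun ε : ℝ => ε ^ ((1 : ℝ) / 2)) := by
  obtain ⟨C, hC⟩ := exists_toReal_klDiv_le hprior hε₀ hΦ h
  refine IsBigO.of_bound C ?_
  filter_upwards [hC] with ε hε
  rw [← Real.sqrt_eq_rpow, Real.norm_of_nonneg ENNReal.toReal_nonneg,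
    Real.norm_of_nonneg (Real.sqrt_nonneg _)]
  exact hε

theorem tendsto_toReal_klDiv (hprior : IsPriorDensity prior) (hε₀ : 0 < ε₀)
    (hΦ : UniformlyBoundedBelow ε₀ Φ) (h : LaplaceAssumption ε₀ prior Φ u) :
    Tendsto (fun ε : ℝ => (klDiv (posterior prior (Φ ε) ε)
      (laplaceApprox prior (Φ ε) ε (u ε))).toReal) (𝓝[>] 0) (𝓝 0) := by
  refine (klDiv_isBigO hprior hε₀ hΦ h).trans_tendsto (tendsto_nhdsWithin_of_tendsto_nhds ?_)
  have := (Real.continuous_rpow_const (q := 1 / 2) (by norm_num)).tendsto 0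
  simpa using this

end Asymptotics

end LaplaceKL

/-! ### The theorem: divergence rate and tightness of the bound -/

theorem mainTheorem1 {d : ℕ} (prior : EuclideanSpace ℝ (Fin d) → ℝ)
    (hprior : LaplaceKL.IsPriorDensity prior) (ε₀ : ℝ) (hε₀ : 0 < ε₀) :
    -- a given instance of the observations
    (∀ (Φ : ℝ → EuclideanSpace ℝ (Fin d) → ℝ) (u : ℝ → EuclideanSpace ℝ (Fin d)),
      LaplaceKL.UniformlyBoundedBelow ε₀ Φ → LaplaceKL.LaplaceAssumption ε₀ prior Φ u →
      (∀ᶠ ε in 𝓝[>] (0 : ℝ), klDiv (LaplaceKL.posterior prior (Φ ε) ε)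
        (LaplaceKL.laplaceApprox prior (Φ ε) ε (u ε)) ≠ ⊤) ∧
      (fun ε : ℝ => (klDiv (LaplaceKL.posterior prior (Φ ε) ε)
        (LaplaceKL.laplaceApprox prior (Φ ε) ε (u ε))).toReal)
          =O[𝓝[>] (0 : ℝ)] (fun ε : ℝ => ε ^ ((1 : ℝ) / 2))) ∧
    -- random observations `y ε`: the lower bound on the expected information gain is tight
    (∀ {Y Ω : Type*} [MeasurableSpace Ω] (P : Measure Ω) [IsProbabilityMeasure P]
      (y : ℝ → Ω → Y) (Φ : ℝ → Y → EuclideanSpace ℝ (Fin d) → ℝ)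
      (u : ℝ → Y → EuclideanSpace ℝ (Fin d)),
      (∀ᵐ ω ∂P, LaplaceKL.UniformlyBoundedBelow ε₀ (fun ε => Φ ε (y ε ω)) ∧
        LaplaceKL.LaplaceAssumption ε₀ prior (fun ε => Φ ε (y ε ω)) (fun ε => u ε (y ε ω))) →
      (∀ ε, 0 < ε → ε ≤ ε₀ → Integrable (fun ω => (klDiv
        (LaplaceKL.posterior prior (Φ ε (y ε ω)) ε) (LaplaceKL.priorMeasure prior)).toReal) P) →
      (∀ ε, 0 < ε → ε ≤ ε₀ → AEStronglyMeasurable (fun ω => (klDiv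
        (LaplaceKL.posterior prior (Φ ε (y ε ω)) ε)
        (LaplaceKL.laplaceApprox prior (Φ ε (y ε ω)) ε (u ε (y ε ω)))).toReal) P) →
      (∃ κ : Ω → ℝ, Integrable κ P ∧ ∀ ε, 0 < ε → ε ≤ ε₀ → ∀ᵐ ω ∂P,
        klDiv (LaplaceKL.posterior prior (Φ ε (y ε ω)) ε)
          (LaplaceKL.laplaceApprox prior (Φ ε (y ε ω)) ε (u ε (y ε ω)))
            ≤ ENNReal.ofReal (κ ω)) →
      (∀ ε, 0 < ε → ε ≤ ε₀ →
        Integrable (fun ω => LaplaceKL.laplaceGain prior (Φ ε (y ε ω)) ε (u ε (y ε ω))) P ∧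
        LaplaceKL.EIGLaplaceLowerBound P prior (Φ ε) (u ε) (y ε) ε ≤
          LaplaceKL.EIG P prior (Φ ε) (y ε) ε) ∧
      Tendsto (fun ε => LaplaceKL.EIG P prior (Φ ε) (y ε) ε -
        LaplaceKL.EIGLaplaceLowerBound P prior (Φ ε) (u ε) (y ε) ε) (𝓝[>] 0) (𝓝 0)) := by
  constructor
  · intro Φ u hΦ h
    refine ⟨?_, LaplaceKL.klDiv_isBigO hprior hε₀ hΦ h⟩
    obtain ⟨c, hc⟩ := hΦ
    filter_upwards [Ioc_mem_nhdsGT hε₀] with ε hε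
    exact (h.isRegularPosterior hprior hc hε.1 hε.2).klDiv_laplaceApprox_ne_top
  · intro Y Ω _ P _ y Φ u hA hEIG hmeas hκ
    obtain ⟨κ, hκint, hκ⟩ := hκ
    have hbound : ∀ ε, 0 < ε → ε ≤ ε₀ → ∀ᵐ ω ∂P, ‖(klDiv
        (LaplaceKL.posterior prior (Φ ε (y ε ω)) ε)
        (LaplaceKL.laplaceApprox prior (Φ ε (y ε ω)) ε (u ε (y ε ω)))).toReal‖ ≤ |κ ω| := by
      intro ε hε hε'
      filter_upwards [hκ ε hε hε'] with ω hω
      rw [Real.norm_of_nonneg ENNReal.toReal_nonneg]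
      exact ENNReal.toReal_le_of_le_ofReal (abs_nonneg _)
        (hω.trans (ENNReal.ofReal_le_ofReal (le_abs_self _)))
    have hKLint : ∀ ε, 0 < ε → ε ≤ ε₀ → Integrable (fun ω => (klDiv
        (LaplaceKL.posterior prior (Φ ε (y ε ω)) ε)
        (LaplaceKL.laplaceApprox prior (Φ ε (y ε ω)) ε (u ε (y ε ω)))).toReal) P :=
      fun ε hε hε' => hκint.abs.mono' (hmeas ε hε hε') (hbound ε hε hε')
    -- This almost sure identity also yields measurability and integrability of the gain, which are
    -- not assumed.
    have hdecomp : ∀ ε, 0 < ε → ε ≤ ε₀ →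
        (fun ω => LaplaceKL.laplaceGain prior (Φ ε (y ε ω)) ε (u ε (y ε ω))) =ᵐ[P]
        fun ω => (klDiv (LaplaceKL.posterior prior (Φ ε (y ε ω)) ε)
            (LaplaceKL.priorMeasure prior)).toReal -
          (klDiv (LaplaceKL.posterior prior (Φ ε (y ε ω)) ε)
            (LaplaceKL.laplaceApprox prior (Φ ε (y ε ω)) ε (u ε (y ε ω)))).toReal := by
      intro ε hε hε'
      filter_upwards [hA] with ω hω
      obtain ⟨⟨c, hc⟩, h⟩ := hω
      rw [(h.isRegularPosterior hprior hc hε hε').toReal_klDiv_priorMeasure]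
      ring
    have hdiff : ∀ ε, 0 < ε → ε ≤ ε₀ → LaplaceKL.EIG P prior (Φ ε) (y ε) ε -
        LaplaceKL.EIGLaplaceLowerBound P prior (Φ ε) (u ε) (y ε) ε =
        ∫ ω, (klDiv (LaplaceKL.posterior prior (Φ ε (y ε ω)) ε)
          (LaplaceKL.laplaceApprox prior (Φ ε (y ε ω)) ε (u ε (y ε ω)))).toReal ∂P := by
      intro ε hε hε'
      rw [LaplaceKL.EIG, LaplaceKL.EIGLaplaceLowerBound, integral_congr_ae (hdecomp ε hε hε'),
        integral_sub (hEIG ε hε hε') (hKLint ε hε hε')]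
      ring
    refine ⟨fun ε hε hε' => ⟨?_, ?_⟩, ?_⟩
    · exact ((hEIG ε hε hε').sub (hKLint ε hε hε')).congr (hdecomp ε hε hε').symm
    · rw [← sub_nonneg, hdiff ε hε hε']
      exact integral_nonneg fun ω => ENNReal.toReal_nonneg
    · have hmem := Ioc_mem_nhdsGT hε₀
      have hlim := tendsto_integral_filter_of_dominated_convergence (μ := P) (l := 𝓝[>] (0 : ℝ))
        (F := fun ε ω => (klDiv (LaplaceKL.posterior prior (Φ ε (y ε ω)) ε)
          (LaplaceKL.laplaceApprox prior (Φ ε (y ε ω)) ε (u ε (y ε ω)))).toReal)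
        (f := fun _ => 0) (fun ω => |κ ω|)
        (by filter_upwards [hmem] with ε hε using hmeas ε hε.1 hε.2)
        (by filter_upwards [hmem] with ε hε using hbound ε hε.1 hε.2)
        hκint.abs
        (by
          filter_upwards [hA] with ω hω
          exact LaplaceKL.tendsto_toReal_klDiv hprior hε₀ hω.1 hω.2)
      rw [integral_zero] at hlim
      refine hlim.congr' ?_
      filter_upwards [hmem] with ε hε
      exact (hdiff ε hε.1 hε.2).symm
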